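/- Let $\mathcal{G}(O\cup U)$ be a finite directed acyclic graph with observed vertices $O$ and hidden vertices $U$. The variables are generated by a nonparametric structural equation model on this graph: $V_i=f_i(\mathrm{pa}(V_i),\varepsilon_i)$ with measurable $f_i$ and jointly independent noises $\varepsilon_i$. The observed variables take values in standard Borel spaces; the treatment $A\in O$ takes exactly two values $a_0\neq a_1$; the outcome $Y\in O$, $Y\ne A$, is real valued. The potential outcome $Y(a_0)$ is the value of $Y$ when the equation of $A$ is replaced by $A=a_0$. Let $P$ be the law of $O$, and let $\mathcal{G}(O)$ be the latent projection: the mixed graph on $O$ with $v\to w$ if there is a directed path from $v$ to $w$ with all intermediate vertices in $U$, and $v\leftrightarrow w$ if $v\neq w$ and there is a collider-free path $v\leftarrow\cdots\to w$ with all intermediate vertices in $U$. The district $\mathrm{dis}(v)$ of $v$ is the set of vertices connected to $v$ by a path of bidirected edges, including $v$. Assume that $A$ is primal fixable in $\mathcal{G}(O)$: no child of $A$ lies in $\mathrm{dis}(A)$. Fix a topological order $\tau$ of $\mathcal{G}(O)$ in which $Y$ is the last element. The Markov pillow $\mathrm{mp}(v)$ is $D\cup\mathrm{pa}(D)$ without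 $v$, where $D$ is the district of $v$ and both are taken in the subgraph on $v$ and its predecessors; put $\mathrm{mp}^{-A}(v)=\mathrm{mp}(v)\setminus\{A\}$. Let $\mathcal{X}$ be the set of variables preceding $A$, let $\mathcal{L}$ consist of $A$ and the variables after $A$ in $\mathrm{dis}(A)$, and let $\mathcal{M}$ be the set of the remaining variables after $A$. Let $Z_1,\dots,Z_K$ be the variables strictly between $A$ and $Y$ in $\tau$, and for $v$ after $A$ let $a_v=a_0$ if $v\in\mathcal{M}$ and $a_v=a_1$ if $v\in\mathcal{L}$. Write $P(\cdot\mid \mathrm{mp}^{-A}(v),a)$ for the regular conditional distribution of $v$ given $\mathrm{mp}(v)$ under $P$, with the treatment, if it belongs to $\mathrm{mp}(v)$, set to $a$. For $a\in\{a_0,a_1\}$ let $$T_a=\prod_{L_i\in\mathcal{L}}dP(l_i\mid \mathrm{mp}^{-A}(l_i),a)\prod_{M_i\in\mathcal{M}}dP(m_i\mid \mathrm{mp}^{-A}(m_i),a_0)\prod_{X_i\in\mathcal{X}}dP(x_i\mid \mathrm{mp}(x_i)),$$ where the factor of $A\in\mathcal{L}$ is $P(A=a\mid\mathrm{mp}(A))$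 (and the coordinate $A$ equals $a$). Assume positivity: for every $v$ after $A$, the law of $(\mathrm{mp}^{-A}(v),a_v)$ under $T_{a_1}$ is absolutely continuous with respect to the law of $\mathrm{mp}(v)$ under $P$ (where $a_v$ is dropped if $A\notin\mathrm{mp}(v)$). Assume also $\mathbb{E}|Y(a_0)|<\infty$. Then $\mathbb{E}[Y(a_0)]$ is identified from $P$ by Tian's functional $$\mathbb{E}[Y(a_0)]=\int y\,dT_{a_0}+\int y\,dT_{a_1},$$ and this equals $\psi_{a_0}(P)$, that is, $$\mathbb{E}[Y(a_0)]=\mathbb{E}\Big[P(a_1\mid\mathrm{mp}(A))\int y\,dP(y\mid\mathrm{mp}^{-A}(y),a_Y)\prod_{k=1}^K dP(z_k\mid\mathrm{mp}^{-A}(z_k),a_{Z_k})\Big]+\mathbb{E}[\mathbb{I}(A=a_0)Y],$$ where the first outer expectation is over the joint distribution of $\mathcal{X}$. All integrals converge absolutely (the inner integral for almost every value of $\mathcal{X}$ with $P(a_1\mid\mathrm{mp}(A))>0$). -/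

import Mathlib

open MeasureTheory ProbabilityTheory

/-! ### Graphs -/

/-- A directed acyclic graph on `V`. -/
structure DAG (V : Type*) where
  edge : V → V → Prop
  acyclic : ∀ v, ¬ Relation.TransGen edge v v

/-- An acyclic directed mixed graph: directed edges `dir v w` (`v → w`) without directed cycles and
bidirected edges `bi v w` (`v ↔ w`). -/
structure ADMG (W : Type*) where
  dir : W → W → Prop
  bi : W → W → Prop
  acyclic : ∀ v, ¬ Relation.TransGen dir v v
  bi_symm : ∀ v w, bi v w → bi w v
  bi_irrefl : ∀ v, ¬ bi v v

namespace DAG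

variable {V : Type*}

/-- There is a directed path of length at least one from the first to the second vertex, all of
whose intermediate vertices are hidden, that is, outside `O`. -/
inductive HiddenPath (H : DAG V) (O : Set V) : V → V → Prop
  | edge {u w : V} : H.edge u w → HiddenPath H O u w
  | cons {u x w : V} : H.edge u x → x ∉ O → HiddenPath H O x w → HiddenPath H O u w

theorem HiddenPath.transGen {H : DAG V} {O : Set V} {u w : V} (h : H.HiddenPath O u w) :
    Relation.TransGen H.edge u w := by
  induction h with
  | edge h => exact .single h
  | cons h _ _ ih => exact .head h ih

/-- The latent projection of `H` onto the observed vertices `O`. A collider-free path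
`v ← ⋯ → w` with hidden intermediate vertices consists of two directed paths with hidden
intermediate vertices that start from one hidden vertex `u` and end in `v` and in `w`. -/
def latentProjection (H : DAG V) (O : Set V) : ADMG O where
  dir v w := H.HiddenPath O v w
  bi v w := v ≠ w ∧ ∃ u, u ∉ O ∧ H.HiddenPath O u v ∧ H.HiddenPath O u w
  acyclic v h := by
    refine H.acyclic v ?_
    have key : ∀ w : O, Relation.TransGen (fun v w : O => H.HiddenPath O v w) v w →
        Relation.TransGen H.edge v w := by
      intro w h
      induction h with
      | single h => exact h.transGen
      | tail _ h ih => exact ih.trans h.transGen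
    exact key v h
  bi_symm := fun _ _ ⟨h, u, hu, h₁, h₂⟩ => ⟨h.symm, u, hu, h₂, h₁⟩
  bi_irrefl := fun _ h => h.1 rfl

theorem wellFounded_edge [Finite V] (H : DAG V) : WellFounded H.edge := by
  have : Std.Irrefl (Relation.TransGen H.edge) := ⟨H.acyclic⟩
  have h : WellFounded (Relation.TransGen H.edge) := Finite.wellFounded_of_trans_of_irrefl _
  exact Subrelation.wf (fun h => Relation.TransGen.single h) h

end DAG

namespace ADMG

variable {W : Type*}

/-- The children of `v`. -/
def children (G : ADMG W) (v : W) : Set W := {w | G.dir v w}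

/-- The union of the parents of the vertices in `S`. -/
def parents (G : ADMG W) (S : Set W) : Set W := {u | ∃ v ∈ S, G.dir u v}

/-- The district of `v`: the vertices connected to `v` by a bidirected path (including `v`). -/
def district (G : ADMG W) (v : W) : Set W := {u | Relation.ReflTransGen G.bi v u}

/-- `v` is primal fixable: its children and its district do not overlap. -/
def PrimalFixable (G : ADMG W) (v : W) : Prop := G.children v ∩ G.district v = ∅

/-- The subgraph on the vertices in `S` (the vertices outside `S` lose all their edges). -/
def restrictTo (G : ADMG W) (S : Set W) : ADMG W where
  dir v w := v ∈ S ∧ w ∈ S ∧ G.dir v w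
  bi v w := v ∈ S ∧ w ∈ S ∧ G.bi v w
  acyclic v h := G.acyclic v (Relation.TransGen.mono (fun _ _ h => h.2.2) _ _ h)
  bi_symm := fun v w h => ⟨h.2.1, h.1, G.bi_symm v w h.2.2⟩
  bi_irrefl := fun v h => G.bi_irrefl v h.2.2

/-- `τ` lists every vertex exactly once, and no vertex is an ancestor of one that precedes it. -/
def IsTopologicalOrder (G : ADMG W) (τ : List W) : Prop :=
  τ.Nodup ∧ (∀ v, v ∈ τ) ∧ τ.Pairwise (fun u v => ¬ Relation.TransGen G.dir v u)

open Classical in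
/-- `u` strictly precedes `v` in the list `τ`. -/
def Precedes (τ : List W) (u v : W) : Prop := τ.idxOf u < τ.idxOf v

/-- The Markov pillow of `v`: the district of `v` and the parents of that district, both taken in
the subgraph on `v` and its predecessors, without `v` itself. -/
def pillow (G : ADMG W) (τ : List W) (v : W) : Set W :=
  let G' := G.restrictTo {u | Precedes τ u v ∨ u = v}
  (G'.district v ∪ G'.parents (G'.district v)) \ {v}

/-- `𝓛`: the treatment `A` and the post-treatment variables in the district of `A`. -/
def setL (G : ADMG W) (τ : List W) (A : W) : Set W :=
  {v | (v = A ∨ Precedes τ A v) ∧ v ∈ G.district A}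

open Classical in
/-- The post-treatment variables, listed in the order `τ`. -/
noncomputable def postTreatment (τ : List W) (A : W) : List W :=
  τ.filter (fun v => decide (Precedes τ A v))

/-! ### The identifying functionals -/

variable {𝒳 : W → Type*}

open Classical in
/-- The treatment level at which the conditional distribution of `v` is evaluated: `a` for the
variables in `𝓛`, and `a₀` for the other post-treatment variables. (The value is irrelevant for a
pre-treatment variable, whose Markov pillow does not contain `A`.) -/
noncomputable def level (G : ADMG W) (τ : List W) (A : W) (a₀ a : 𝒳 A) (v : W) : 𝒳 A :=
  if v ∈ G.setL τ A then a else a₀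

open Classical in
/-- The values `(mp^{-A}(v), a)` of the Markov pillow of `v`: the coordinates of `o`, except that
the treatment, if it belongs to the pillow, is set to `a`. -/
noncomputable def pillowAt (G : ADMG W) (τ : List W) (A v : W) (a : 𝒳 A) (o : ∀ w, 𝒳 w) :
    ∀ u : G.pillow τ v, 𝒳 u :=
  fun u => Function.update o A a u

variable [∀ v, MeasurableSpace (𝒳 v)]

open Classical in
theorem measurable_pillowAt (G : ADMG W) (τ : List W) (A v : W) (a : 𝒳 A) :
    Measurable (G.pillowAt τ A v a) := by
  refine measurable_pi_lambda _ fun u => ?_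
  exact (measurable_pi_apply (u : W)).comp measurable_update_left

open Classical in
theorem measurable_updateAt (v : W) :
    Measurable (fun p : (∀ w, 𝒳 w) × 𝒳 v => Function.update p.1 v p.2) :=
  measurable_update'

variable [∀ v, StandardBorelSpace (𝒳 v)] [∀ v, Nonempty (𝒳 v)]

/-- `P(· ∣ mp(v))`: the regular conditional distribution of the coordinate `v` given its Markov
pillow, under the law `P` of the observed variables. -/
noncomputable def condLaw (G : ADMG W) (τ : List W) (P : Measure (∀ w, 𝒳 w)) [IsFiniteMeasure P]
    (v : W) : Kernel (∀ u : G.pillow τ v, 𝒳 u) (𝒳 v) :=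
  condDistrib (fun o => o v) (fun o (u : G.pillow τ v) => o u) P

/-- `o ↦ P(· ∣ mp^{-A}(v), a)`. -/
noncomputable def factor (G : ADMG W) (τ : List W) (A : W) (P : Measure (∀ w, 𝒳 w))
    [IsFiniteMeasure P] (v : W) (a : 𝒳 A) : Kernel (∀ w, 𝒳 w) (𝒳 v) :=
  (G.condLaw τ P v).comap (G.pillowAt τ A v a) (G.measurable_pillowAt τ A v a)

open Classical in
/-- Replace the coordinate `v` of `o` by a draw from `P(· ∣ mp^{-A}(v), a)`. -/
noncomputable def draw (G : ADMG W) (τ : List W) (A : W) (P : Measure (∀ w, 𝒳 w))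
    [IsFiniteMeasure P] (v : W) (a : 𝒳 A) : Kernel (∀ w, 𝒳 w) (∀ w, 𝒳 w) :=
  (Kernel.id ×ₖ G.factor τ A P v a).map (fun p => Function.update p.1 v p.2)

/-- The product `∏_{v ∈ l} dP(v ∣ mp^{-A}(v), c v)`: the coordinates in the list `l` are drawn one
after the other, the others are kept. -/
noncomputable def product (G : ADMG W) (τ : List W) (A : W) (P : Measure (∀ w, 𝒳 w))
    [IsFiniteMeasure P] (c : W → 𝒳 A) : List W → Kernel (∀ w, 𝒳 w) (∀ w, 𝒳 w)
  | [] => Kernel.id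
  | v :: l => G.product τ A P c l ∘ₖ G.draw τ A P v (c v)

/-- The measure
`∏_{𝓛} dP(l ∣ mp^{-A}(l), a) ∏_{𝓜} dP(m ∣ mp^{-A}(m), a₀) ∏ dP(x ∣ mp(x))`, where the last product is
over the pre-treatment variables and the factor of the treatment itself (which belongs to `𝓛`) is the probability `P(A = a ∣ mp(A))`: all variables are
drawn in the order `τ`, restricted to the event that the draw of the treatment is `a`. All the
coordinates of the initial point are overwritten before they are read. -/
noncomputable def branch (G : ADMG W) (τ : List W) (A : W) (P : Measure (∀ w, 𝒳 w))
    [IsFiniteMeasure P] (a₀ a : 𝒳 A) : Measure (∀ w, 𝒳 w) :=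
  (G.product τ A P (G.level τ A a₀ a) τ (Classical.arbitrary _)).restrict {o | o A = a}

/-- Tian's identifying functional
`∫ y {∏_{𝓛} dP(l ∣ mp^{-A}(l), a₀) + ∏_{𝓛} dP(l ∣ mp^{-A}(l), a₁)} ∏_{𝓜} dP(m ∣ mp^{-A}(m), a₀)
∏ dP(x ∣ mp(x))`, where `x` runs over the pre-treatment variables. -/
noncomputable def tianFunctional (G : ADMG W) (τ : List W) (A Y : W) (P : Measure (∀ w, 𝒳 w))
    [IsFiniteMeasure P] (y : 𝒳 Y → ℝ) (a₀ a₁ : 𝒳 A) : ℝ :=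
  ∫ o, y (o Y) ∂(G.branch τ A P a₀ a₀) + ∫ o, y (o Y) ∂(G.branch τ A P a₀ a₁)

/-- `P(A = a ∣ mp(A))`, as a function of the observed variables. -/
noncomputable def propensity (G : ADMG W) (τ : List W) (A : W) (P : Measure (∀ w, 𝒳 w))
    [IsFiniteMeasure P] (a : 𝒳 A) (o : ∀ w, 𝒳 w) : ℝ :=
  (G.condLaw τ P A (fun u => o u)).real {a}

/-- The measure `dP(y ∣ mp^{-A}(y), a_Y) ∏_k dP(z_k ∣ mp^{-A}(z_k), a_{Z_k})` (the post-treatment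
variables, the last of which is the outcome, are drawn in the order `τ`). It is a function of the
observed variables through the pre-treatment variables only. -/
noncomputable def postLaw (G : ADMG W) (τ : List W) (A : W) (P : Measure (∀ w, 𝒳 w))
    [IsFiniteMeasure P] (a₀ a₁ : 𝒳 A) : Kernel (∀ w, 𝒳 w) (∀ w, 𝒳 w) :=
  G.product τ A P (G.level τ A a₀ a₁) (postTreatment τ A)

/-- The functional `ψ_{a₀}(P) = E[P(a₁ ∣ mp(A)) ∫ y dP(y ∣ mp^{-A}(y), a_Y)
∏_k dP(z_k ∣ mp^{-A}(z_k), a_{Z_k})] + E[𝟙(A = a₀) Y]`. The random variable inside the first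
expectation is a function of the pre-treatment variables. -/
noncomputable def psi (G : ADMG W) (τ : List W) (A Y : W) (P : Measure (∀ w, 𝒳 w))
    [IsFiniteMeasure P] (y : 𝒳 Y → ℝ) (a₀ a₁ : 𝒳 A) : ℝ :=
  ∫ o, G.propensity τ A P a₁ o * (∫ o', y (o' Y) ∂(G.postLaw τ A P a₀ a₁ o)) ∂P
    + ∫ o, Set.indicator {o | o A = a₀} (fun o => y (o Y)) o ∂P

/-- Positivity: under the measure integrated in the functional, the values
`(mp^{-A}(v), a_v)` at which the conditional distribution of a post-treatment variable `v` is
evaluated avoid every null set of the law of the Markov pillow `mp(v)`, so that the conditional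
distribution is determined by `P` there. For the laws of a causal model this holds, for example, if
`0 < P(A = a₀ ∣ all observed variables but A and Y) < 1` almost surely; if the outcome is the only
post-treatment variable, then `P(A = a₀ ∣ pre-treatment variables) > 0` almost surely suffices. -/
def Positivity (G : ADMG W) (τ : List W) (A : W) (P : Measure (∀ w, 𝒳 w))
    [IsFiniteMeasure P] (a₀ a₁ : 𝒳 A) : Prop :=
  ∀ v, Precedes τ A v →
    (G.branch τ A P a₀ a₁).map (G.pillowAt τ A v (G.level τ A a₀ a₁ v)) ≪
      P.map (fun o (u : G.pillow τ v) => o u)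

end ADMG

/-! ### Structural causal models and potential outcomes -/

/-- The structural equations `v = f v (pa v, noise of v)` of a nonparametric structural equation
model on the DAG `H`. -/
structure SCM {V : Type*} (H : DAG V) (𝒳 ℰ : V → Type*) [∀ v, MeasurableSpace (𝒳 v)]
    [∀ v, MeasurableSpace (ℰ v)] where
  f : ∀ v, (∀ p : {p // H.edge p v}, 𝒳 p) → ℰ v → 𝒳 v
  measurable_f : ∀ v,
    Measurable (fun x : (∀ p : {p // H.edge p v}, 𝒳 p) × ℰ v => f v x.1 x.2)

namespace SCM

variable {V : Type*} [Finite V] {H : DAG V} {𝒳 ℰ : V → Type*} [∀ v, MeasurableSpace (𝒳 v)]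
  [∀ v, MeasurableSpace (ℰ v)]

/-- The solution of the structural equations at the noise `e`, when each variable `v` with
`I v = some x` is set to `x` instead of following its equation. -/
noncomputable def solve (M : SCM H 𝒳 ℰ) (I : ∀ v, Option (𝒳 v)) (e : ∀ v, ℰ v) : ∀ v, 𝒳 v :=
  H.wellFounded_edge.fix fun v rec => (I v).getD (M.f v (fun p => rec p p.2) (e v))

theorem solve_eq (M : SCM H 𝒳 ℰ) (I : ∀ v, Option (𝒳 v)) (e : ∀ v, ℰ v) (v : V) :
    M.solve I e v = (I v).getD (M.f v (fun p => M.solve I e p) (e v)) := by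
  unfold solve
  rw [WellFounded.fix_eq]

/-- The values of all variables, without any intervention. -/
noncomputable def factual (M : SCM H 𝒳 ℰ) (e : ∀ v, ℰ v) : ∀ v, 𝒳 v :=
  M.solve (fun _ => none) e

open Classical in
/-- The potential outcomes of all variables when the treatment `A` is set to `a`. -/
noncomputable def potential (M : SCM H 𝒳 ℰ) (A : V) (a : 𝒳 A) (e : ∀ v, ℰ v) : ∀ v, 𝒳 v :=
  M.solve (Function.update (fun _ => none) A (some a)) e

end SCM

/-!
# Identification of a primal fixable treatment effect by Tian's functional

The proof compares the functional with the *hybrid world*: the treatment keeps its natural value,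
while every other variable responds to the treatment value `a₀`. In this world the outcome is
`Y(a₀)`, so `E[Y(a₀)]` splits into integrals over the events that the natural treatment is `a₀`
and `a₁`, and it suffices that the measure `branch a₀ a` is the law of the hybrid world on the
event that the natural treatment is `a` (`branch_eq_map_hybrid`, `branch_self_eq_map_hybrid`).
This is shown one variable at a time along the topological order: given its past in the hybrid
world, `v` has to follow the conditional distribution `P(v ∣ mp(v))` of the factual world, at the
level `a` or `a₀` of the treatment (`measure_hybrid_inter_eq_setLIntegral`).

Eliminating the hidden variables gives each observed variable an equation in its parents in the
latent projection and in a set of noises; the noise sets of two variables overlap only if the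
variables are joined by a bidirected edge (`DAG.bi_of_mem_noiseSet`). Hence the noises of the
district `D` of `v` among `v` and its predecessors are independent of all noises outside `D`, and
this independence is inherited along the order, conditionally on the Markov pillow
(`condInd_of_sequential`).

A conditional distribution is only determined almost everywhere, so it cannot be carried from one
world to the other by comparing formulas. Instead a fair coin is tossed between the factual world
and a second world with the same equations in `D`. The coin counts as a noise outside `D`, so it
is conditionally irrelevant to `v` given the Markov pillow, and the two worlds share a version of
the conditional distribution; positivity guarantees that this version agrees with `P(v ∣ mp(v))`
where the functional evaluates it (`measure_inter_eq_setLIntegral_condLaw`). If `v` is in the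
district of the treatment, primal fixability says that no equation in `D` involves the treatment,
and the second world is the hybrid one, as it is if `v` does not follow the treatment. Otherwise
the treatment is outside `D`, and the second world is that of the potential outcomes, in which the
natural treatment is a function of the past and of noises outside `D`.

Finally, integrating out the treatment in `branch a₀ a₁` produces the propensity and leads to the
functional `psi` (`ADMG.lintegral_branch`).
-/

/-! ### Conditional independence of σ-algebras -/

section CondInd

variable {Ω : Type*} {m₁ m₂ m' n : MeasurableSpace Ω} {mΩ : MeasurableSpace Ω} {μ : Measure Ω}

/-- Conditional independence of `m₁` and `m₂` given `m'`, in the integrated form that characterises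
it when `m'` is contained in `m₁` or in `m₂`. No assumption on `Ω` is needed. -/
def CondInd (μ : Measure Ω) (m₁ m₂ m' : MeasurableSpace Ω) : Prop :=
  ∀ s t, MeasurableSet[m₁] s → MeasurableSet[m₂] t →
    μ.real (s ∩ t) = ∫ ω, (μ⟦s|m'⟧) ω * (μ⟦t|m'⟧) ω ∂μ

theorem CondInd.symm (h : CondInd μ m₁ m₂ m') : CondInd μ m₂ m₁ m' := by
  intro s t hs ht
  rw [Set.inter_comm, h t s ht hs]
  simp only [mul_comm]

variable [IsFiniteMeasure μ]

theorem integrable_indicator_one {s : Set Ω} (hs : MeasurableSet s) :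
    Integrable (s.indicator fun _ => (1 : ℝ)) μ :=
  (integrable_const 1).indicator hs

theorem setIntegral_condProb (hm : m' ≤ mΩ) {s t : Set Ω} (hs : MeasurableSet s) :
    ∫ ω in s, (μ⟦t|m'⟧) ω ∂μ = ∫ ω, (μ⟦s|m'⟧) ω * (μ⟦t|m'⟧) ω ∂μ := by
  have h1 : (fun ω => s.indicator (fun _ => (1 : ℝ)) ω * (μ⟦t|m'⟧) ω)
      = s.indicator (μ⟦t|m'⟧) := by
    funext ω
    by_cases h : ω ∈ s <;> simp [h]
  have hint : Integrable (s.indicator (fun _ => (1 : ℝ)) * μ⟦t|m'⟧) μ := by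
    change Integrable (fun ω => s.indicator (fun _ => (1 : ℝ)) ω * (μ⟦t|m'⟧) ω) μ
    rw [h1]
    exact integrable_condExp.indicator hs
  have h2 := condExp_mul_of_stronglyMeasurable_right (m := m')
    (stronglyMeasurable_condExp (f := t.indicator fun _ => (1 : ℝ)) (μ := μ)) hint
    (integrable_indicator_one hs)
  rw [← integral_indicator hs, ← h1]
  change ∫ ω, (s.indicator (fun _ => (1 : ℝ)) * μ⟦t|m'⟧) ω ∂μ = _
  rw [← integral_condExp hm, integral_congr_ae h2]
  rfl

theorem setIntegral_condProb_comm (hm : m' ≤ mΩ) {s t : Set Ω} (hs : MeasurableSet s)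
    (ht : MeasurableSet t) :
    ∫ ω in s, (μ⟦t|m'⟧) ω ∂μ = ∫ ω in t, (μ⟦s|m'⟧) ω ∂μ := by
  rw [setIntegral_condProb hm hs, setIntegral_condProb hm ht]
  simp only [mul_comm]

theorem condInd_iff_setIntegral (h₁ : m₁ ≤ mΩ) (hm : m' ≤ mΩ) :
    CondInd μ m₁ m₂ m' ↔ ∀ s t, MeasurableSet[m₁] s → MeasurableSet[m₂] t →
      μ.real (s ∩ t) = ∫ ω in s, (μ⟦t|m'⟧) ω ∂μ := by
  refine forall₄_congr fun s t hs _ => ?_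
  rw [setIntegral_condProb hm (h₁ _ hs)]

omit [IsFiniteMeasure μ] in
theorem setIntegral_indicator_one {s t : Set Ω} (ht : MeasurableSet t) :
    ∫ ω in s, t.indicator (fun _ => (1 : ℝ)) ω ∂μ = μ.real (s ∩ t) := by
  rw [setIntegral_indicator ht]
  simp

/-- Conditional independence given a sub-σ-algebra `m'` of `m₁` means that `m₁` predicts the events
of `m₂` no better than `m'` does. -/
theorem condInd_iff_condProb (h₁ : m₁ ≤ mΩ) (h₂ : m₂ ≤ mΩ) (h' : m' ≤ m₁) :
    CondInd μ m₁ m₂ m' ↔ ∀ t, MeasurableSet[m₂] t → μ⟦t|m'⟧ =ᵐ[μ] μ⟦t|m₁⟧ := by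
  rw [condInd_iff_setIntegral h₁ (h'.trans h₁)]
  constructor
  · intro h t ht
    refine ae_eq_condExp_of_forall_setIntegral_eq h₁ (integrable_indicator_one (h₂ _ ht))
      (fun _ _ _ => integrable_condExp.integrableOn) (fun s hs _ => ?_)
      (stronglyMeasurable_condExp.mono h').aestronglyMeasurable
    rw [← h s t hs ht, setIntegral_indicator_one (h₂ _ ht)]
  · intro h s t hs ht
    rw [integral_congr_ae (ae_restrict_of_ae (h t ht)),
      setIntegral_condExp h₁ (integrable_indicator_one (h₂ _ ht)) hs,
      setIntegral_indicator_one (h₂ _ ht)]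

theorem isPiSystem_inter (m₂ n : MeasurableSpace Ω) :
    IsPiSystem {b | ∃ c e, MeasurableSet[m₂] c ∧ MeasurableSet[n] e ∧ b = c ∩ e} := by
  rintro _ ⟨c, e, hc, he, rfl⟩ _ ⟨c', e', hc', he', rfl⟩ _
  exact ⟨c ∩ c', e ∩ e', hc.inter hc', he.inter he', Set.inter_inter_inter_comm ..⟩

theorem sup_eq_generateFrom_inter (m₂ n : MeasurableSpace Ω) :
    m₂ ⊔ n = .generateFrom
      {b | ∃ c e, MeasurableSet[m₂] c ∧ MeasurableSet[n] e ∧ b = c ∩ e} := by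
  apply le_antisymm
  · refine sup_le (fun c hc => ?_) (fun e he => ?_)
    · exact .basic _ ⟨c, Set.univ, hc, .univ, by simp⟩
    · exact .basic _ ⟨Set.univ, e, .univ, he, by simp⟩
  · refine MeasurableSpace.generateFrom_le ?_
    rintro _ ⟨c, e, hc, he, rfl⟩
    exact MeasurableSet.inter ((le_sup_left : m₂ ≤ m₂ ⊔ n) _ hc)
      ((le_sup_right : n ≤ m₂ ⊔ n) _ he)

/-- A variable that is a function of one side may be disclosed to both: if `n` is contained in
`m₁`, then `m₁` remains conditionally independent of `m₂ ⊔ n` given `m' ⊔ n`. -/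
theorem CondInd.sup_right (h : CondInd μ m₁ m₂ m') (h₁ : m₁ ≤ mΩ) (h₂ : m₂ ≤ mΩ) (h' : m' ≤ m₁)
    (hn : n ≤ m₁) : CondInd μ m₁ (m₂ ⊔ n) (m' ⊔ n) := by
  have hq : m' ⊔ n ≤ mΩ := (sup_le h' hn).trans h₁
  have h₂n : m₂ ⊔ n ≤ mΩ := sup_le h₂ (hn.trans h₁)
  rw [condInd_iff_condProb h₁ h₂ h'] at h
  intro s b hs hb
  rw [← setIntegral_condProb hq (h₁ _ hs), setIntegral_condProb_comm hq (h₁ _ hs) (h₂n _ hb)]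
  induction b, hb using
    MeasurableSpace.induction_on_inter (sup_eq_generateFrom_inter m₂ n) (isPiSystem_inter m₂ n) with
  | empty => simp
  | basic b hb =>
    obtain ⟨c, e, hc, he, rfl⟩ := hb
    have hce : MeasurableSet (c ∩ e) := (h₂ _ hc).inter (h₁ _ (hn _ he))
    -- conditionally on `m₁`, the indicator of `e` is a constant
    have key : μ⟦c ∩ e|m₁⟧ =ᵐ[μ] e.indicator (μ⟦c|m'⟧) := by
      have h3 : (c ∩ e).indicator (fun _ => (1 : ℝ))
          = e.indicator (c.indicator fun _ => (1 : ℝ)) := by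
        rw [Set.indicator_indicator, Set.inter_comm]
      rw [h3]
      refine (condExp_indicator (integrable_indicator_one (h₂ _ hc)) (hn _ he)).trans ?_
      filter_upwards [h c hc] with ω hω
      by_cases hωe : ω ∈ e
      · rw [Set.indicator_of_mem hωe, Set.indicator_of_mem hωe, hω]
      · rw [Set.indicator_of_notMem hωe, Set.indicator_of_notMem hωe]
    have hsm : StronglyMeasurable[m' ⊔ n] (e.indicator (μ⟦c|m'⟧)) :=
      (stronglyMeasurable_condExp.mono le_sup_left).indicator
        ((le_sup_right : n ≤ m' ⊔ n) _ he)
    have key2 : μ⟦c ∩ e|m' ⊔ n⟧ =ᵐ[μ] μ⟦c ∩ e|m₁⟧ := by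
      refine (condExp_condExp_of_le (sup_le h' hn) h₁).symm.trans ?_
      refine (condExp_congr_ae key).trans ?_
      rw [condExp_of_stronglyMeasurable hq hsm (integrable_condExp.indicator (h₁ _ (hn _ he)))]
      exact key.symm
    rw [← setIntegral_condProb_comm hq (h₁ _ hs) hce, integral_congr_ae (ae_restrict_of_ae key2),
      setIntegral_condExp h₁ (integrable_indicator_one hce) hs, setIntegral_indicator_one hce]
  | compl b hb ih =>
    have hb' := h₂n _ hb
    have h5 := integral_add_compl hb' (integrable_condExp (f := s.indicator fun _ => (1 : ℝ))
      (m := m' ⊔ n) (μ := μ))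
    rw [integral_condExp hq, integral_indicator_const _ (h₁ _ hs)] at h5
    have h6 := measureReal_inter_add_sdiff (μ := μ) (s := s) hb'
    rw [Set.sdiff_eq] at h6
    simp only [smul_eq_mul, mul_one] at h5
    linarith
  | iUnion f hd hf ih =>
    have hf' : ∀ i, MeasurableSet (f i) := fun i => h₂n _ (hf i)
    rw [integral_iUnion hf' hd integrable_condExp.integrableOn, Set.inter_iUnion, measureReal_def,
      measure_iUnion (fun i j hij => (hd hij).mono Set.inter_subset_right Set.inter_subset_right)
        (fun i => (h₁ _ hs).inter (hf' i)),
      ENNReal.tsum_toReal_eq (fun i => measure_ne_top _ _)]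
    exact tsum_congr ih

theorem CondInd.sup_left (h : CondInd μ m₁ m₂ m') (h₁ : m₁ ≤ mΩ) (h₂ : m₂ ≤ mΩ) (h' : m' ≤ m₂)
    (hn : n ≤ m₂) : CondInd μ (m₁ ⊔ n) m₂ (m' ⊔ n) :=
  (h.symm.sup_right h₂ h₁ h' hn).symm

omit [IsFiniteMeasure μ] in
theorem condInd_bot_of_indep [IsProbabilityMeasure μ] (h : Indep m₁ m₂ μ) (h₁ : m₁ ≤ mΩ)
    (h₂ : m₂ ≤ mΩ) : CondInd μ m₁ m₂ ⊥ := by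
  intro s t hs ht
  rw [condExp_bot, condExp_bot, integral_indicator_const _ (h₁ _ hs),
    integral_indicator_const _ (h₂ _ ht)]
  have := (Indep_iff m₁ m₂ μ).1 h s t hs ht
  simp [measureReal_def, this]

/-- Under conditional independence given `X`, a regular conditional distribution of `Y` given `X`
remains one when it is evaluated on the larger σ-algebra `m₂`. -/
theorem CondInd.measure_inter_preimage {α β : Type*} {mα : MeasurableSpace α}
    [MeasurableSpace β] [StandardBorelSpace β] [Nonempty β] {X : Ω → α} {Y : Ω → β}
    (h : CondInd μ m₁ m₂ (mα.comap X)) (h₂ : m₂ ≤ mΩ) (hX : Measurable X) (hY : Measurable Y)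
    (hY₁ : Measurable[m₁] Y) {C : Set Ω} (hC : MeasurableSet[m₂] C) {F : Set β}
    (hF : MeasurableSet F) :
    μ (C ∩ Y ⁻¹' F) = ∫⁻ ω in C, condDistrib Y X μ (X ω) F ∂μ := by
  have h3 := (condInd_iff_setIntegral h₂ hX.comap_le).1 h.symm C _ hC (hY₁ hF)
  have h4 := condDistrib_ae_eq_condExp (μ := μ) hX hY hF
  rw [integral_congr_ae (ae_restrict_of_ae h4.symm)] at h3
  have h5 : Measurable fun ω => condDistrib Y X μ (X ω) F :=
    ((condDistrib Y X μ).measurable_coe hF).comp hX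
  simp only [measureReal_def] at h3
  rw [integral_toReal h5.aemeasurable (ae_of_all _ fun _ => measure_lt_top _ _)] at h3
  refine (ENNReal.toReal_eq_toReal_iff' (measure_ne_top _ _) ?_).1 h3
  refine (lt_of_le_of_lt (lintegral_mono fun _ => prob_le_one) ?_).ne
  simp

end CondInd

/-! ### A sequential Markov property -/

section Sequential

variable {Ω W : Type*} {𝒳 : W → Type*} [∀ w, MeasurableSpace (𝒳 w)]

/-- The σ-algebra generated by the coordinates in `T` of the process `N`. -/
@[reducible]
def coordAlg (N : Ω → ∀ w, 𝒳 w) (T : Set W) : MeasurableSpace Ω :=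
  ⨆ u ∈ T, MeasurableSpace.comap (fun ω => N ω u) inferInstance

variable {N : Ω → ∀ w, 𝒳 w}

theorem coordAlg_mono {S T : Set W} (h : S ⊆ T) : coordAlg N S ≤ coordAlg N T :=
  biSup_mono h

theorem measurable_coordAlg {T : Set W} {u : W} (h : u ∈ T) :
    Measurable[coordAlg N T] (fun ω => N ω u) :=
  measurable_iff_comap_le.2 (le_biSup (fun u => MeasurableSpace.comap (fun ω => N ω u) _) h)

theorem coordAlg_le {m : MeasurableSpace Ω} {T : Set W}
    (h : ∀ u ∈ T, Measurable[m] fun ω => N ω u) : coordAlg N T ≤ m :=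
  iSup₂_le fun u hu => (h u hu).comap_le

theorem coordAlg_insert (w : W) (T : Set W) : coordAlg N (insert w T)
    = coordAlg N T ⊔ MeasurableSpace.comap (fun ω => N ω w) inferInstance := by
  rw [coordAlg, iSup_insert, sup_comm]

theorem coordAlg_eq_comap (T : Set W) :
    coordAlg N T = MeasurableSpace.comap (fun ω (u : T) => N ω u) inferInstance := by
  simp only [coordAlg, MeasurableSpace.pi, MeasurableSpace.comap_iSup, MeasurableSpace.comap_comp,
    iSup_subtype]
  rfl

/-- Let each coordinate of a process, in a given order, be produced either from the noise `mD` and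
preceding coordinates in `S`, and then belong to `S` itself, or from the noise `mR` and any
preceding coordinates. If the two noises are independent, then they remain so given the
coordinates in `S`, also jointly with the coordinates that they see. -/
theorem condInd_of_sequential {mD mR : MeasurableSpace Ω} {mΩ : MeasurableSpace Ω}
    {μ : Measure Ω} [IsProbabilityMeasure μ]
    (hN : ∀ w, Measurable fun ω => N ω w) (hD : mD ≤ mΩ) (hR : mR ≤ mΩ) (hind : Indep mD mR μ)
    (idx : W → ℕ) (hidx : Function.Injective idx) (S : Set W) (n : ℕ)
    (hstep : ∀ w, idx w < n →
      (w ∈ S ∧ Measurable[mD ⊔ coordAlg N (S ∩ {u | idx u < idx w})] fun ω => N ω w) ∨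
      Measurable[mR ⊔ coordAlg N {u | idx u < idx w}] fun ω => N ω w) :
    CondInd μ (mD ⊔ coordAlg N (S ∩ {u | idx u < n})) (mR ⊔ coordAlg N {u | idx u < n})
      (coordAlg N (S ∩ {u | idx u < n})) := by
  have hle : ∀ T, coordAlg N T ≤ mΩ := fun T => coordAlg_le fun u _ => hN u
  induction n with
  | zero =>
    have h0 : {u | idx u < 0} = ∅ := by ext; simp
    have h1 : coordAlg N ∅ = ⊥ := by simp [coordAlg]
    rw [h0, Set.inter_empty, h1, sup_bot_eq, sup_bot_eq]
    exact condInd_bot_of_indep hind hD hR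
  | succ k ih =>
    have ih := ih fun w hw => hstep w (hw.trans k.lt_succ_self)
    by_cases hk : ∃ w, idx w = k
    · obtain ⟨w, rfl⟩ := hk
      have h1 : {u | idx u < idx w + 1} = insert w {u | idx u < idx w} := by
        ext u
        simp only [Set.mem_ofPred_eq, Set.mem_insert_iff, Nat.lt_succ_iff_lt_or_eq, hidx.eq_iff,
          or_comm]
      rw [h1, coordAlg_insert]
      by_cases hwS : w ∈ S
      · rw [Set.inter_comm, Set.insert_inter_of_mem hwS, coordAlg_insert, Set.inter_comm]
        rcases hstep w (Nat.lt_succ_self _) with ⟨-, h⟩ | h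
        · have h' := ih.sup_right (sup_le hD (hle _)) (sup_le hR (hle _)) le_sup_right
            h.comap_le
          rwa [← sup_assoc, ← sup_assoc, sup_eq_left.2 h.comap_le]
        · have h' := ih.sup_left (sup_le hD (hle _)) (sup_le hR (hle _))
            ((coordAlg_mono Set.inter_subset_right).trans le_sup_right) h.comap_le
          rwa [← sup_assoc, ← sup_assoc,
            sup_eq_left (a := mR ⊔ coordAlg N {u | idx u < idx w}).2 h.comap_le]
      · rcases hstep w (Nat.lt_succ_self _) with ⟨h, -⟩ | h
        · exact absurd h hwS
        · rw [Set.inter_comm, Set.insert_inter_of_notMem hwS, Set.inter_comm, ← sup_assoc,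
            sup_eq_left (a := mR ⊔ coordAlg N {u | idx u < idx w}).2 h.comap_le]
          exact ih
    · have h1 : {u | idx u < k + 1} = {u | idx u < k} := by
        ext u
        simp only [Set.mem_ofPred_eq, Nat.lt_succ_iff_lt_or_eq, or_iff_left_iff_imp]
        exact fun h => absurd ⟨u, h⟩ hk
      rw [h1]
      exact ih

end Sequential

/-! ### Topological orders, prefix districts and Markov pillows -/

namespace ADMG

section Order

variable {W : Type*} {G : ADMG W} {τ : List W}

open Classical in
/-- The position of `v` in the list `τ`; `Precedes` compares positions. -/
noncomputable def position (τ : List W) (v : W) : ℕ := τ.idxOf v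

open Classical in
theorem precedes_iff_mem_left {l₁ l₂ : List W} {v : W} (h : (l₁ ++ v :: l₂).Nodup) (u : W) :
    Precedes (l₁ ++ v :: l₂) u v ↔ u ∈ l₁ := by
  have hv : v ∉ l₁ := fun hv => (List.disjoint_of_nodup_append h) hv List.mem_cons_self
  unfold Precedes
  rw [List.idxOf_append_of_notMem (a := v) hv, List.idxOf_cons_self, add_zero]
  by_cases hu : u ∈ l₁
  · simp [List.idxOf_append_of_mem hu, List.idxOf_lt_length_iff, hu]
  · simp [List.idxOf_append_of_notMem hu, hu]

theorem Precedes.trans {u v w : W} (h : Precedes τ u v) (h' : Precedes τ v w) : Precedes τ u w :=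
  Nat.lt_trans h h'

theorem not_precedes_self (v : W) : ¬ Precedes τ v v := Nat.lt_irrefl _

/-- The district of `v` in the subgraph on `v` and its predecessors. -/
def prefixDistrict (G : ADMG W) (τ : List W) (v : W) : Set W :=
  (G.restrictTo {u | Precedes τ u v ∨ u = v}).district v

theorem self_mem_prefixDistrict (v : W) : v ∈ G.prefixDistrict τ v := .refl

theorem precedes_or_eq_of_mem_prefixDistrict {v d : W} (h : d ∈ G.prefixDistrict τ v) :
    Precedes τ d v ∨ d = v := by
  induction h with
  | refl => exact .inr rfl
  | tail _ h _ => exact h.2.1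

theorem mem_prefixDistrict_of_bi {v d w : W} (h : d ∈ G.prefixDistrict τ v)
    (hw : Precedes τ w v ∨ w = v) (hdw : G.bi d w) : w ∈ G.prefixDistrict τ v :=
  Relation.ReflTransGen.tail h ⟨precedes_or_eq_of_mem_prefixDistrict h, hw, hdw⟩

theorem prefixDistrict_subset_district (v : W) : G.prefixDistrict τ v ⊆ G.district v :=
  fun _ h => Relation.ReflTransGen.mono (fun _ _ h => h.2.2) _ _ h

theorem mem_pillow_of_mem_prefixDistrict {v d : W} (h : d ∈ G.prefixDistrict τ v) (hd : d ≠ v) :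
    d ∈ G.pillow τ v :=
  ⟨.inl h, hd⟩

namespace IsTopologicalOrder

theorem position_injective (hτ : G.IsTopologicalOrder τ) : Function.Injective (position τ) := by
  classical exact fun u _ h => (List.idxOf_inj (hτ.2.1 u)).1 h

theorem trichotomy (hτ : G.IsTopologicalOrder τ) (u v : W) :
    Precedes τ u v ∨ u = v ∨ Precedes τ v u := by
  rcases lt_trichotomy (position τ u) (position τ v) with h | h | h
  · exact .inl h
  · exact .inr (.inl (hτ.position_injective h))
  · exact .inr (.inr h)

theorem precedes_of_dir (hτ : G.IsTopologicalOrder τ) {u v : W} (h : G.dir u v) :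
    Precedes τ u v := by
  rcases hτ.trichotomy u v with h' | rfl | h'
  · exact h'
  · exact absurd (.single h) (G.acyclic u)
  · obtain ⟨l₁, l₂, rfl⟩ := List.append_of_mem (hτ.2.1 u)
    have hv := (precedes_iff_mem_left hτ.1 v).1 h'
    exact absurd (.single h)
      ((List.pairwise_append.1 hτ.2.2).2.2 v hv u List.mem_cons_self)

theorem mem_pillow_of_dir (hτ : G.IsTopologicalOrder τ) {p d v : W}
    (hd : d ∈ G.prefixDistrict τ v) (h : G.dir p d) : p ∈ G.pillow τ v := by
  have hp := hτ.precedes_of_dir h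
  have hd' := precedes_or_eq_of_mem_prefixDistrict hd
  have hpv : Precedes τ p v := by
    rcases hd' with h' | rfl
    exacts [hp.trans h', hp]
  refine ⟨.inr ⟨d, hd, .inl hpv, hd', h⟩, ?_⟩
  rintro rfl
  exact not_precedes_self _ hpv

end IsTopologicalOrder

theorem precedes_of_mem_pillow {u v : W} (h : u ∈ G.pillow τ v) : Precedes τ u v := by
  obtain ⟨h | ⟨d, -, h, -⟩, hne⟩ := h
  · exact (precedes_or_eq_of_mem_prefixDistrict h).resolve_right hne
  · exact h.resolve_right hne

theorem pairwise_precedes (h : τ.Nodup) : τ.Pairwise (Precedes τ) := by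
  classical
  refine List.pairwise_iff_getElem.2 fun i j hi hj hij => ?_
  unfold Precedes
  have := h.idxOf_getElem i hi
  have := h.idxOf_getElem j hj
  convert hij

theorem postTreatment_append_cons {l₁ l₂ : List W} {A : W} (h : (l₁ ++ A :: l₂).Nodup) :
    postTreatment (l₁ ++ A :: l₂) A = l₂ := by
  classical
  have hmem := precedes_iff_mem_left h
  have hd := List.disjoint_of_nodup_append h
  unfold postTreatment
  rw [List.filter_append, List.filter_cons_of_neg (by simp [not_precedes_self]),
    List.filter_eq_nil_iff.2, List.filter_eq_self.2, List.nil_append]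
  · intro u hu
    have hu' : u ∉ l₁ := fun hu' => hd hu' (List.mem_cons_of_mem _ hu)
    have hA : A ∉ l₁ := fun hA => hd hA List.mem_cons_self
    have hne : A ≠ u := fun he =>
      (List.nodup_cons.1 (List.nodup_append.1 h).2.1).1 (he ▸ hu)
    refine decide_eq_true ?_
    unfold Precedes
    rw [List.idxOf_append_of_notMem hA, List.idxOf_append_of_notMem hu', List.idxOf_cons_self,
      List.idxOf_cons_ne _ hne]
    omega
  · intro u hu
    simp only [decide_eq_true_eq]
    exact fun h' => Nat.lt_asymm h' ((hmem u).2 hu)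

end Order

/-! ### Products of draws -/

section Product

variable {W : Type*} {𝒳 : W → Type*} [∀ v, MeasurableSpace (𝒳 v)]
  [∀ v, StandardBorelSpace (𝒳 v)] [∀ v, Nonempty (𝒳 v)]
  (G : ADMG W) (τ : List W) (A : W) (P : Measure (∀ w, 𝒳 w)) [IsProbabilityMeasure P]

instance (v : W) : IsMarkovKernel (G.condLaw τ P v) := by
  unfold condLaw; infer_instance

instance (v : W) (a : 𝒳 A) : IsMarkovKernel (G.factor τ A P v a) := by
  unfold factor; infer_instance

instance (v : W) (a : 𝒳 A) : IsMarkovKernel (G.draw τ A P v a) := by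
  unfold draw
  exact Kernel.IsMarkovKernel.map _ (measurable_updateAt v)

instance (c : W → 𝒳 A) (l : List W) : IsMarkovKernel (G.product τ A P c l) := by
  induction l with
  | nil => unfold product; infer_instance
  | cons v l ih => unfold product; infer_instance

theorem product_append (c : W → 𝒳 A) (l₁ l₂ : List W) :
    G.product τ A P c (l₁ ++ l₂) = G.product τ A P c l₂ ∘ₖ G.product τ A P c l₁ := by
  induction l₁ with
  | nil => rw [List.nil_append, product, Kernel.comp_id]
  | cons v l ih => rw [List.cons_append, product, product, ih, Kernel.comp_assoc]

open Classical in
theorem lintegral_draw (v : W) (a : 𝒳 A) (o : ∀ w, 𝒳 w) {f : (∀ w, 𝒳 w) → ENNReal}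
    (hf : Measurable f) : ∫⁻ q, f q ∂(G.draw τ A P v a o)
      = ∫⁻ x, f (Function.update o v x) ∂(G.condLaw τ P v (G.pillowAt τ A v a o)) := by
  have h := hf.comp (measurable_updateAt (𝒳 := 𝒳) v)
  rw [draw, Kernel.lintegral_map _ (measurable_updateAt v) _ hf, Kernel.prod_apply,
    lintegral_prod _ (by exact h.aemeasurable), Kernel.id_apply, lintegral_dirac']
  · rw [factor, Kernel.comap_apply]
  · exact Measurable.lintegral_prod_right' h

theorem lintegral_product_cons (c : W → 𝒳 A) (v : W) (l : List W) (o : ∀ w, 𝒳 w)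
    {f : (∀ w, 𝒳 w) → ENNReal} (hf : Measurable f) :
    ∫⁻ q, f q ∂(G.product τ A P c (v :: l) o)
      = ∫⁻ q, ∫⁻ r, f r ∂(G.product τ A P c l q) ∂(G.draw τ A P v (c v) o) := by
  rw [product, Kernel.lintegral_comp _ _ _ hf]

omit [∀ v, Nonempty (𝒳 v)] in
theorem measurableSet_coord_eq (u : W) (x : 𝒳 u) : MeasurableSet {q : ∀ w, 𝒳 w | q u = x} :=
  (measurable_pi_apply u) (measurableSet_singleton x)

theorem draw_ae (v : W) (a : 𝒳 A) (o : ∀ w, 𝒳 w) (u : W) (hu : u ≠ v) :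
    ∀ᵐ q ∂(G.draw τ A P v a o), q u = o u := by
  classical
  have hs := (measurableSet_coord_eq (𝒳 := 𝒳) u (o u)).compl
  rw [ae_iff]
  change (G.draw τ A P v a o) {q | q u = o u}ᶜ = 0
  rw [← lintegral_indicator_one hs, lintegral_draw _ _ _ _ _ _ _ (measurable_one.indicator hs)]
  simp [hu]

/-- A product of draws keeps the coordinates that it does not draw. -/
theorem product_ae (c : W → 𝒳 A) (l : List W) (o : ∀ w, 𝒳 w) (u : W) (hu : u ∉ l) :
    ∀ᵐ q ∂(G.product τ A P c l o), q u = o u := by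
  induction l generalizing o with
  | nil =>
    rw [product, Kernel.id_apply, ae_dirac_iff (measurableSet_coord_eq u (o u))]
  | cons v l ih =>
    rw [List.mem_cons, not_or] at hu
    have hs := (measurableSet_coord_eq (𝒳 := 𝒳) u (o u)).compl
    rw [ae_iff]
    change (G.product τ A P c (v :: l) o) {q | q u = o u}ᶜ = 0
    rw [product, Kernel.comp_apply' _ _ _ hs, lintegral_eq_zero_iff (Kernel.measurable_coe _ hs)]
    filter_upwards [G.draw_ae τ A P v (c v) o u hu.1] with q hq
    have h := ih q hu.2
    rw [hq, ae_iff] at h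
    exact h

omit [∀ v, MeasurableSpace (𝒳 v)] [∀ v, StandardBorelSpace (𝒳 v)] [∀ v, Nonempty (𝒳 v)] in
theorem pillowAt_treatment {A v : W} (hA : A ∈ G.pillow τ v) (a : 𝒳 A) (o : ∀ w, 𝒳 w) :
    G.pillowAt τ A v a o ⟨A, hA⟩ = a := by
  classical exact Function.update_self ..

omit [∀ v, MeasurableSpace (𝒳 v)] [∀ v, StandardBorelSpace (𝒳 v)] [∀ v, Nonempty (𝒳 v)] in
theorem pillowAt_of_ne {A v : W} (a : 𝒳 A) (o : ∀ w, 𝒳 w) (u : G.pillow τ v)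
    (hu : (u : W) ≠ A) : G.pillowAt τ A v a o u = o u := by
  classical exact Function.update_of_ne hu ..

omit [∀ v, MeasurableSpace (𝒳 v)] [∀ v, StandardBorelSpace (𝒳 v)] [∀ v, Nonempty (𝒳 v)] in
theorem pillowAt_congr {A v : W} (a : 𝒳 A) {o o' : ∀ w, 𝒳 w}
    (h : ∀ u ∈ G.pillow τ v, u ≠ A → o u = o' u) :
    G.pillowAt τ A v a o = G.pillowAt τ A v a o' := by
  classical
  funext u
  unfold pillowAt
  by_cases hu : (u : W) = A
  · obtain ⟨u, hu'⟩ := u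
    subst hu
    simp
  · simp [hu, h u u.2 hu]

open Classical in
/-- Up to the coordinate of the treatment, a product of draws depends on the initial point only
through the coordinates that are neither drawn nor the treatment. -/
theorem product_map_update_congr (c : W → 𝒳 A) (a : 𝒳 A) (l : List W)
    (hself : ∀ v ∈ l, v ∉ G.pillow τ v) (hl : l.Pairwise fun u v => v ∉ G.pillow τ u)
    (o o' : ∀ w, 𝒳 w) (h : ∀ u, u ∉ l → u ≠ A → o u = o' u)
    {f : (∀ w, 𝒳 w) → ENNReal} (hf : Measurable f) :
    ∫⁻ q, f (Function.update q A a) ∂(G.product τ A P c l o)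
      = ∫⁻ q, f (Function.update q A a) ∂(G.product τ A P c l o') := by
  have hf' : Measurable fun q : ∀ w, 𝒳 w => f (Function.update q A a) :=
    hf.comp measurable_update_left
  induction l generalizing o o' with
  | nil =>
    rw [product, Kernel.id_apply, Kernel.id_apply, lintegral_dirac' _ hf', lintegral_dirac' _ hf']
    congr 1
    funext u
    by_cases hu : u = A
    · subst hu; simp
    · simp [hu, h u (by simp) hu]
  | cons v l ih =>
    rw [List.pairwise_cons] at hl
    have hm : Measurable fun q =>
        ∫⁻ r, f (Function.update r A a) ∂(G.product τ A P c l q) := hf'.lintegral_kernel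
    rw [lintegral_product_cons _ _ _ _ _ _ _ _ hf', lintegral_product_cons _ _ _ _ _ _ _ _ hf',
      lintegral_draw _ _ _ _ _ _ _ hm, lintegral_draw _ _ _ _ _ _ _ hm,
      G.pillowAt_congr τ (c v) (o := o) (o' := o')]
    · refine lintegral_congr fun x => ih (fun u hu => hself u (List.mem_cons_of_mem _ hu)) hl.2 _ _
        fun u hu huA => ?_
      by_cases huv : u = v
      · subst huv; simp
      · simp [huv, h u (by simp [huv, hu]) huA]
    · intro u hu huA
      refine h u (fun hmem => ?_) huA
      rcases List.mem_cons.1 hmem with rfl | hmem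
      · exact hself _ List.mem_cons_self hu
      · exact hl.1 u hmem hu

end Product

end ADMG

/-! ### Structural equations of the observed variables -/

namespace DAG

variable {V : Type*} {H : DAG V} {O : Set V}

theorem HiddenPath.tail {u p w : V} (h : H.HiddenPath O u p) (hp : p ∉ O) (hw : H.edge p w) :
    H.HiddenPath O u w := by
  induction h with
  | edge h => exact .cons h hp (.edge hw)
  | cons h hx _ ih => exact .cons h hx (ih hp hw)

/-- The vertices whose noises enter the equation of `w` once the hidden variables have been
eliminated from it: `w` itself, and the hidden vertices with a hidden path to `w`. -/
def noiseSet (H : DAG V) (O : Set V) (w : V) : Set V :=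
  {s | s = w ∨ s ∉ O ∧ H.HiddenPath O s w}

theorem noiseSet_subset {p w : V} (hp : p ∉ O) (hw : H.edge p w) :
    H.noiseSet O p ⊆ H.noiseSet O w := by
  rintro s (rfl | ⟨hs, h⟩)
  · exact .inr ⟨hp, .edge hw⟩
  · exact .inr ⟨hs, h.tail hp hw⟩

/-- Two observed variables whose equations share a noise are joined by a bidirected edge. -/
theorem bi_of_mem_noiseSet {v w : O} (hvw : v ≠ w) {s : V} (hv : s ∈ H.noiseSet O v)
    (hw : s ∈ H.noiseSet O w) : (H.latentProjection O).bi v w := by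
  rcases hv with rfl | ⟨hs, hv⟩
  · rcases hw with h | ⟨hs, -⟩
    · exact absurd (Subtype.ext h) hvw
    · exact absurd v.2 hs
  · rcases hw with rfl | ⟨-, hw⟩
    · exact absurd w.2 hs
    · exact ⟨hvw, s, hs, hv, hw⟩

end DAG

namespace SCM

variable {V : Type*} [Finite V] {H : DAG V} {𝒳 ℰ : V → Type*} [∀ v, MeasurableSpace (𝒳 v)]
  [∀ v, MeasurableSpace (ℰ v)] (M : SCM H 𝒳 ℰ) {O : Set V}

open Classical in
/-- The equation of `x` after elimination of the hidden variables: its value when the observed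
variables other than `x` are set to `z`. -/
noncomputable def reduced (z : ∀ v : O, 𝒳 v) (e : ∀ v, ℰ v) (x : V) : 𝒳 x :=
  M.f x (fun p => M.solve (fun q => if h : q ∈ O then some (z ⟨q, h⟩) else none) e p) (e x)

open Classical in
theorem reduced_eq (z : ∀ v : O, 𝒳 v) (e : ∀ v, ℰ v) (x : V) :
    M.reduced z e x
      = M.f x (fun p => if h : (p : V) ∈ O then z ⟨p, h⟩ else M.reduced z e p) (e x) := by
  rw [reduced]
  congr 1
  funext p
  rw [solve_eq]
  split_ifs with h
  · rfl
  · rfl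

/-- Under an intervention on observed variables, every other variable follows its reduced
equation. -/
theorem solve_eq_reduced (I : ∀ v, Option (𝒳 v)) (hI : ∀ q, q ∉ O → I q = none) (e : ∀ v, ℰ v)
    {x : V} (hx : I x = none) :
    M.solve I e x = M.reduced (fun v : O => M.solve I e v) e x := by
  classical
  induction x using H.wellFounded_edge.induction with
  | _ x ih =>
    rw [solve_eq, hx, Option.getD_none, reduced_eq]
    congr 1
    funext p
    split_ifs with h
    · rfl
    · exact ih p p.2 (hI p h)

theorem reduced_congr {z z' : ∀ v : O, 𝒳 v} (e : ∀ v, ℰ v) (x : V)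
    (h : ∀ p : O, H.HiddenPath O p x → z p = z' p) : M.reduced z e x = M.reduced z' e x := by
  classical
  induction x using H.wellFounded_edge.induction with
  | _ x ih =>
    rw [reduced_eq, reduced_eq]
    congr 1
    funext p
    split_ifs with hp
    · exact h ⟨p, hp⟩ (.edge p.2)
    · exact ih p p.2 fun q hq => h q (hq.tail hp p.2)

theorem measurable_reduced {Ω : Type*} {m : MeasurableSpace Ω} {z : Ω → ∀ v : O, 𝒳 v}
    {e : Ω → ∀ v, ℰ v} (x : V) (hz : ∀ p : O, H.HiddenPath O p x → Measurable fun ω => z ω p)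
    (he : ∀ s ∈ H.noiseSet O x, Measurable fun ω => e ω s) :
    Measurable fun ω => M.reduced (z ω) (e ω) x := by
  classical
  induction x using H.wellFounded_edge.induction with
  | _ x ih =>
    simp_rw [fun ω => M.reduced_eq (z ω) (e ω) x]
    refine (M.measurable_f x).comp (Measurable.prodMk ?_ (he x (.inl rfl)))
    refine measurable_pi_lambda _ fun p => ?_
    by_cases hp : (p : V) ∈ O
    · exact (congrArg Measurable (funext fun ω => dif_pos hp)).mpr (hz ⟨p, hp⟩ (.edge p.2))
    · refine (congrArg Measurable (funext fun ω => dif_neg hp)).mpr ?_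
      exact ih p p.2 (fun q hq => hz q (hq.tail hp p.2))
        fun s hs => he s (DAG.noiseSet_subset hp p.2 hs)

theorem measurable_solve (I : ∀ v, Option (𝒳 v)) (x : V) :
    Measurable fun e => M.solve I e x := by
  induction x using H.wellFounded_edge.induction with
  | _ x ih =>
    simp_rw [fun e => M.solve_eq I e x]
    cases I x with
    | some a => exact measurable_const
    | none =>
      exact (M.measurable_f x).comp
        (Measurable.prodMk (measurable_pi_lambda _ fun p => ih p p.2) (measurable_pi_apply x))

theorem factual_eq_reduced (e : ∀ v, ℰ v) (x : V) :
    M.factual e x = M.reduced (fun v : O => M.factual e v) e x :=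
  M.solve_eq_reduced _ (fun _ _ => rfl) e rfl

theorem potential_treatment (A : V) (a : 𝒳 A) (e : ∀ v, ℰ v) : M.potential A a e A = a := by
  rw [potential, solve_eq]
  simp

theorem potential_eq_reduced (A : O) (a : 𝒳 A) (e : ∀ v, ℰ v) {x : V} (hx : x ≠ A) :
    M.potential A a e x = M.reduced (fun v : O => M.potential A a e v) e x := by
  refine M.solve_eq_reduced _ (fun q hq => ?_) e (by simp [hx])
  have : q ≠ A := fun h => hq (h ▸ A.2)
  simp [this]

/-- Consistency: where the treatment takes the value `a` by itself, setting it to `a` changes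
nothing. -/
theorem potential_eq_factual {A : V} {a : 𝒳 A} {e : ∀ v, ℰ v} (h : M.factual e A = a) (x : V) :
    M.potential A a e x = M.factual e x := by
  classical
  induction x using H.wellFounded_edge.induction with
  | _ x ih =>
    by_cases hx : x = A
    · subst hx
      rw [potential_treatment, h]
    · rw [potential, factual, solve_eq, solve_eq, Function.update_of_ne hx]
      simp only [Option.getD_none]
      congr 1
      funext p
      exact ih p p.2

/-- Setting the treatment does not affect the variables that precede it. -/
theorem potential_eq_factual_of_not_precedes {τ : List O} {A : O}
    (hτ : (H.latentProjection O).IsTopologicalOrder τ) (a : 𝒳 A) (e : ∀ v, ℰ v) {w : O}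
    (hwA : w ≠ A) (hw : ¬ ADMG.Precedes τ A w) : M.potential A a e w = M.factual e w := by
  induction hk : ADMG.position τ w using Nat.strong_induction_on generalizing w with
  | _ k ih =>
    subst hk
    have hne : (w : V) ≠ A := fun h => hwA (Subtype.ext h)
    rw [M.potential_eq_reduced A a e hne, M.factual_eq_reduced (O := O)]
    refine M.reduced_congr e _ fun p hp => ?_
    have hpw : ADMG.Precedes τ p w := hτ.precedes_of_dir hp
    exact ih _ hpw (fun h => hw (h ▸ hpw)) (fun h => hw (h.trans hpw)) rfl

open Classical in
/-- The world in which the treatment keeps its natural value, but all other variables respond to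
the value `a` instead. -/
noncomputable def hybrid (A : O) (a : 𝒳 A) (e : ∀ v, ℰ v) : ∀ v : O, 𝒳 v :=
  Function.update (fun v : O => M.potential A a e v) A (M.factual e A)

theorem hybrid_treatment (A : O) (a : 𝒳 A) (e : ∀ v, ℰ v) :
    M.hybrid A a e A = M.factual e A := by
  simp [hybrid]

theorem hybrid_of_ne {A : O} (a : 𝒳 A) (e : ∀ v, ℰ v) {w : O} (hw : w ≠ A) :
    M.hybrid A a e w = M.potential A a e w := by
  simp [hybrid, hw]

open Classical in
theorem update_hybrid (A : O) (a : 𝒳 A) (e : ∀ v, ℰ v) :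
    Function.update (M.hybrid A a e) A a = fun v : O => M.potential A a e v := by
  funext v
  by_cases hv : v = A
  · subst hv
    simp [potential_treatment]
  · simp [hybrid, hv]

open Classical in
/-- In the hybrid world every variable, the treatment included, follows its reduced equation with
the treatment replaced by `a`: the treatment is not among its own parents. -/
theorem hybrid_eq_reduced {τ : List O} {A : O}
    (hτ : (H.latentProjection O).IsTopologicalOrder τ) (a : 𝒳 A) (e : ∀ v, ℰ v) (w : O) :
    M.hybrid A a e w = M.reduced (Function.update (M.hybrid A a e) A a) e w := by
  rw [update_hybrid]
  by_cases hw : w = A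
  · subst hw
    rw [hybrid_treatment, M.factual_eq_reduced (O := O)]
    refine M.reduced_congr e _ fun p hp => ?_
    have hpw : ADMG.Precedes τ p w := hτ.precedes_of_dir hp
    refine (M.potential_eq_factual_of_not_precedes hτ a e ?_ fun h => ?_).symm
    · rintro rfl
      exact ADMG.not_precedes_self _ hpw
    · exact ADMG.not_precedes_self _ (h.trans hpw)
  · rw [hybrid_of_ne _ _ _ hw, M.potential_eq_reduced A a e fun h => hw (Subtype.ext h)]

theorem hybrid_eq_factual_of_not_precedes {τ : List O} {A : O}
    (hτ : (H.latentProjection O).IsTopologicalOrder τ) (a : 𝒳 A) (e : ∀ v, ℰ v) {w : O}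
    (hw : ¬ ADMG.Precedes τ A w) : M.hybrid A a e w = M.factual e w := by
  by_cases hwA : w = A
  · subst hwA
    exact M.hybrid_treatment w a e
  · rw [hybrid_of_ne _ _ _ hwA, M.potential_eq_factual_of_not_precedes hτ a e hwA hw]

theorem hybrid_eq_factual {A : O} {a : 𝒳 A} {e : ∀ v, ℰ v} (h : M.factual e A = a) (w : O) :
    M.hybrid A a e w = M.factual e w := by
  by_cases hwA : w = A
  · subst hwA
    exact M.hybrid_treatment w a e
  · rw [hybrid_of_ne _ _ _ hwA, M.potential_eq_factual h]

end SCM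

/-! ### An independent fair coin -/

section Coin

variable {Ω : Type*} {mΩ : MeasurableSpace Ω} {μ : Measure Ω} [IsProbabilityMeasure μ]

/-- The law of a fair coin. -/
noncomputable def fairCoin : Measure Bool := (PMF.uniformOfFintype Bool).toMeasure

instance : IsProbabilityMeasure fairCoin := by unfold fairCoin; infer_instance

theorem fairCoin_singleton (b : Bool) : fairCoin {b} = 2⁻¹ := by simp [fairCoin]

theorem setLIntegral_prod_fairCoin {g : Ω × Bool → ENNReal} (hg : Measurable g) (C : Set Ω)
    (b : Bool) : ∫⁻ p in C ×ˢ {b}, g p ∂(μ.prod fairCoin) = 2⁻¹ * ∫⁻ ω in C, g (ω, b) ∂μ := by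
  rw [← Measure.prod_restrict, Measure.restrict_singleton, Measure.prod_smul_right,
    Measure.prod_dirac, lintegral_smul_measure, fairCoin_singleton,
    lintegral_map hg measurable_prodMk_right, smul_eq_mul]

variable {V : Type*} {ℰ : V → Type*} [∀ v, MeasurableSpace (ℰ v)] {ε : ∀ v, Ω → ℰ v}

/-- The noises in a set of vertices are independent of the remaining ones together with the
coin. -/
theorem indep_noise_coin (hε : ∀ v, Measurable (ε v)) (hindep : iIndepFun ε μ) (S : Set V) :
    Indep (coordAlg (fun (p : Ω × Bool) v => ε v p.1) S)
      (coordAlg (fun (p : Ω × Bool) v => ε v p.1) Sᶜ ⊔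
        MeasurableSpace.comap (Prod.snd : Ω × Bool → Bool) inferInstance) (μ.prod fairCoin) := by
  have hcomap : ∀ T : Set V, coordAlg (fun (p : Ω × Bool) v => ε v p.1) T
      = MeasurableSpace.comap Prod.fst (coordAlg (fun ω v => ε v ω) T) := by
    intro T
    simp only [coordAlg, MeasurableSpace.comap_iSup, MeasurableSpace.comap_comp]
    rfl
  have hle : ∀ T : Set V, coordAlg (fun ω v => ε v ω) T ≤ mΩ := fun T =>
    coordAlg_le fun v _ => hε v
  have hle' : ∀ T : Set V, coordAlg (fun (p : Ω × Bool) v => ε v p.1) T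
      ≤ (inferInstance : MeasurableSpace (Ω × Bool)) := fun T =>
    coordAlg_le fun v _ => (hε v).comp measurable_fst
  have hind : Indep (coordAlg (fun ω v => ε v ω) S) (coordAlg (fun ω v => ε v ω) Sᶜ) μ :=
    indep_iSup_of_disjoint (fun v => (hε v).comap_le) hindep.iIndep disjoint_compl_right
  refine IndepSets.indep (hle' S) (sup_le (hle' _) measurable_snd.comap_le)
    (@MeasurableSpace.isPiSystem_measurableSet _ (coordAlg _ S)) (isPiSystem_inter _ _)
    (@MeasurableSpace.generateFrom_measurableSet _ (coordAlg _ S)).symm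
    (sup_eq_generateFrom_inter _ _) ?_
  rw [IndepSets_iff]
  rintro s _ hs ⟨c, e, hc, he, rfl⟩
  rw [Set.mem_ofPred_eq, hcomap] at hs
  rw [hcomap] at hc
  obtain ⟨s, hs, rfl⟩ := hs
  obtain ⟨c, hc, rfl⟩ := hc
  obtain ⟨e, he, rfl⟩ := he
  have h1 : Prod.fst ⁻¹' s ∩ (Prod.fst ⁻¹' c ∩ Prod.snd ⁻¹' e) = (s ∩ c) ×ˢ e := by
    ext; simp [and_assoc]
  have h2 : (Prod.fst ⁻¹' c ∩ Prod.snd ⁻¹' e : Set (Ω × Bool)) = c ×ˢ e := rfl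
  have h3 : (Prod.fst ⁻¹' s : Set (Ω × Bool)) = s ×ˢ Set.univ := by ext; simp
  rw [h1, h2, h3, Measure.prod_prod, Measure.prod_prod, Measure.prod_prod, measure_univ, mul_one,
    (Indep_iff _ _ μ).1 hind s c hs hc, mul_assoc]

end Coin

/-! ### Transport of conditional distributions between two worlds -/

section Transport

variable {V : Type*} [Finite V] {H : DAG V} {O : Set V}
  {𝒳 ℰ : V → Type*} [∀ v, MeasurableSpace (𝒳 v)] [∀ v, MeasurableSpace (ℰ v)]
  (M : SCM H 𝒳 ℰ) {Ω : Type*} [mΩ : MeasurableSpace Ω] {μ : Measure Ω}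
  [IsProbabilityMeasure μ] {ε : ∀ v, Ω → ℰ v}

/-- The joint process of two worlds: a coin decides between the factual world (`false`) and the
world `N` (`true`). -/
noncomputable def mixed (ε : ∀ v, Ω → ℰ v) (N : Ω → ∀ w : O, 𝒳 w) (p : Ω × Bool) (w : O) : 𝒳 w :=
  match p.2 with
  | true => N p.1 w
  | false => M.factual (fun s => ε s p.1) w

/-- The noises that enter the equations of the prefix district of `v`. -/
@[reducible]
def insideAlg (H : DAG V) (τ : List O) (ε : ∀ v, Ω → ℰ v) (v : O) : MeasurableSpace (Ω × Bool) :=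
  coordAlg (fun (p : Ω × Bool) s => ε s p.1)
    (⋃ d ∈ (H.latentProjection O).prefixDistrict τ v, H.noiseSet O d)

/-- The noises that do not enter the equations of the prefix district of `v`, together with the
coin. -/
@[reducible]
def outsideAlg (H : DAG V) (τ : List O) (ε : ∀ v, Ω → ℰ v) (v : O) : MeasurableSpace (Ω × Bool) :=
  coordAlg (fun (p : Ω × Bool) s => ε s p.1)
    (⋃ d ∈ (H.latentProjection O).prefixDistrict τ v, H.noiseSet O d)ᶜ ⊔
    MeasurableSpace.comap (Prod.snd : Ω × Bool → Bool) inferInstance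

omit [Finite V] in
theorem noiseSet_subset_outside {τ : List O} {v w : O} (hw : ADMG.Precedes τ w v)
    (hwD : w ∉ (H.latentProjection O).prefixDistrict τ v) :
    H.noiseSet O w ⊆ (⋃ d ∈ (H.latentProjection O).prefixDistrict τ v, H.noiseSet O d)ᶜ := by
  intro s hs hs'
  obtain ⟨d, hd, hsd⟩ := Set.mem_iUnion₂.1 hs'
  refine hwD (ADMG.mem_prefixDistrict_of_bi hd (.inl hw) (DAG.bi_of_mem_noiseSet ?_ hsd hs))
  rintro rfl
  exact hwD hd

/-- The past of `v` in the joint process: the variables that precede `v` in the world that the coin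
selects, the coin itself, and all noises that do not enter the prefix district of `v`. -/
@[reducible]
noncomputable def historyAlg (τ : List O) (ε : ∀ v, Ω → ℰ v) (N : Ω → ∀ w : O, 𝒳 w) (v : O) :
    MeasurableSpace (Ω × Bool) :=
  outsideAlg H τ ε v ⊔ coordAlg (mixed M ε N) {u | ADMG.Precedes τ u v}

variable {M}

theorem measurable_factual (hε : ∀ v, Measurable (ε v)) (w : V) :
    Measurable fun ω => M.factual (fun s => ε s ω) w :=
  (M.measurable_solve _ w).comp (measurable_pi_lambda _ hε)

theorem measurable_mixed (hε : ∀ v, Measurable (ε v)) {N : Ω → ∀ w : O, 𝒳 w}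
    (hN : ∀ w, Measurable fun ω => N ω w) (w : O) : Measurable fun p => mixed M ε N p w := by
  refine measurable_from_prod_countable_left fun b => ?_
  cases b
  · exact measurable_factual hε w
  · exact hN w

theorem measurable_of_coin {α β : Type*} [MeasurableSpace β] {m : MeasurableSpace (α × Bool)}
    {f g h : α × Bool → β} (hm : Measurable[m] (Prod.snd : α × Bool → Bool))
    (hg : Measurable g) (hh : Measurable h) (h₁ : ∀ a, f (a, true) = g (a, true))
    (h₀ : ∀ a, f (a, false) = h (a, false)) : Measurable f := by
  have hs : MeasurableSet {p : α × Bool | p.2 = true} := hm (measurableSet_singleton true)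
  have : f = fun p => if p.2 = true then g p else h p := by
    funext ⟨a, b⟩
    cases b
    · simp [h₀]
    · simp [h₁]
  rw [this]
  exact Measurable.ite hs hg hh

variable [∀ v : O, StandardBorelSpace (𝒳 v)] [∀ v : O, Nonempty (𝒳 v)]
  {P : Measure (∀ v : O, 𝒳 v)} [IsProbabilityMeasure P]

open Classical in
/-- Let the equations of the prefix district of `v` be the same in the world `N` as in the factual
world, whereas outside this district a variable may be held constant or see the treatment at the
value `a`. Then `P(v ∣ mp(v))` is also the conditional distribution of `v` given its past in the
world `N`, on every event of the past (the section of `C'` at `true`) on which the law of the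
Markov pillow is dominated by its factual law: tossing a coin between the worlds, the coin is
conditionally irrelevant to `v`, so the two worlds share a version of the conditional
distribution. -/
theorem measure_inter_eq_setLIntegral_condLaw
    (hε : ∀ v, Measurable (ε v)) (hindep : iIndepFun ε μ)
    (hP : P = μ.map (fun ω (v : O) => M.factual (fun w => ε w ω) v))
    {τ : List O} (hτ : (H.latentProjection O).IsTopologicalOrder τ) (v : O) {A : O} (a : 𝒳 A)
    {N : Ω → ∀ w : O, 𝒳 w} (hN : ∀ w, Measurable fun ω => N ω w)
    (hD : ∀ d ∈ (H.latentProjection O).prefixDistrict τ v, ∀ ω,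
      N ω d = M.reduced (N ω) (fun s => ε s ω) d)
    (hR : ∀ w, ADMG.Precedes τ w v → w ∉ (H.latentProjection O).prefixDistrict τ v →
      (∃ x, ∀ ω, N ω w = x) ∨
      ∀ ω, N ω w = M.reduced (Function.update (N ω) A a) (fun s => ε s ω) w)
    {C' : Set (Ω × Bool)} (hC' : MeasurableSet[historyAlg M τ ε N v] C')
    (hac : (μ.restrict ((fun ω => (ω, true)) ⁻¹' C')).map
      (fun ω (u : (H.latentProjection O).pillow τ v) => N ω u) ≪
        P.map (fun o (u : (H.latentProjection O).pillow τ v) => o u))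
    {F : Set (𝒳 v)} (hF : MeasurableSet F) :
    μ ((fun ω => (ω, true)) ⁻¹' C' ∩ {ω | N ω v ∈ F}) =
      ∫⁻ ω in (fun ω => (ω, true)) ⁻¹' C',
        (H.latentProjection O).condLaw τ P v (fun u => N ω u) F ∂μ := by
  set G := H.latentProjection O with hG
  set S : Set O := G.pillow τ v with hS
  set D := G.prefixDistrict τ v with hDdef
  set R := mixed M ε N with hRdef
  have hRm : ∀ w, Measurable fun p => R p w := measurable_mixed hε hN
  have hSpre : S ∩ {u | ADMG.Precedes τ u v} = S :=
    Set.inter_eq_left.2 fun u hu => ADMG.precedes_of_mem_pillow hu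
  have hnoise : ∀ T, coordAlg (fun (p : Ω × Bool) s => ε s p.1) T
      ≤ (inferInstance : MeasurableSpace (Ω × Bool)) := fun T =>
    coordAlg_le fun s _ => (hε s).comp measurable_fst
  have hout : outsideAlg H τ ε v ≤ (inferInstance : MeasurableSpace (Ω × Bool)) :=
    sup_le (hnoise _) measurable_snd.comap_le
  have hhist : historyAlg M τ ε N v ≤ (inferInstance : MeasurableSpace (Ω × Bool)) :=
    sup_le hout (coordAlg_le fun u _ => hRm u)
  -- the equations in the prefix district do not involve the coin
  have hRD : ∀ d ∈ D, ∀ p, R p d = M.reduced (R p) (fun s => ε s p.1) d := by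
    rintro d hd ⟨ω, b⟩
    cases b
    · exact M.factual_eq_reduced (O := O) _ _
    · exact hD d hd ω
  have hmeasD : ∀ d ∈ D, ∀ T : Set O, (∀ p, G.dir p d → p ∈ T) →
      Measurable[insideAlg H τ ε v ⊔ coordAlg R T] fun p => R p d := by
    intro d hd T hT
    simp_rw [hRD d hd]
    refine M.measurable_reduced _ (fun p hp => ?_) fun s hs => ?_
    · exact (measurable_coordAlg (N := R) (hT p hp)).mono le_sup_right le_rfl
    · exact (measurable_coordAlg (𝒳 := ℰ) (N := fun (p : Ω × Bool) s => ε s p.1)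
        (Set.mem_iUnion₂.2 ⟨d, hd, hs⟩)).mono le_sup_left le_rfl
  have hmeasR : ∀ w, ADMG.Precedes τ w v → w ∉ D →
      Measurable[outsideAlg H τ ε v ⊔ coordAlg R {u | ADMG.Precedes τ u w}] fun p => R p w := by
    intro w hw hwD
    have hcoord : ∀ p, G.dir p w → Measurable[outsideAlg H τ ε v ⊔
        coordAlg R {u | ADMG.Precedes τ u w}] fun q => R q p := fun p hp =>
      (measurable_coordAlg (N := R) (T := {u | ADMG.Precedes τ u w})
        (hτ.precedes_of_dir hp)).mono le_sup_right le_rfl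
    have hnoise' : ∀ s ∈ H.noiseSet O w, Measurable[outsideAlg H τ ε v ⊔
        coordAlg R {u | ADMG.Precedes τ u w}] fun q => ε s q.1 := fun s hs =>
      (measurable_coordAlg (𝒳 := ℰ) (N := fun (p : Ω × Bool) s => ε s p.1)
        (noiseSet_subset_outside hw hwD hs)).mono (le_sup_left.trans le_sup_left) le_rfl
    have hfac : Measurable[outsideAlg H τ ε v ⊔ coordAlg R {u | ADMG.Precedes τ u w}]
        fun p => M.reduced (R p) (fun s => ε s p.1) w :=
      M.measurable_reduced _ hcoord hnoise'
    have hcoin : Measurable[outsideAlg H τ ε v ⊔ coordAlg R {u | ADMG.Precedes τ u w}]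
        (Prod.snd : Ω × Bool → Bool) :=
      (comap_measurable Prod.snd).mono (le_sup_right.trans le_sup_left) le_rfl
    rcases hR w hw hwD with ⟨x, hx⟩ | hx
    · exact measurable_of_coin hcoin (measurable_const (a := x)) hfac hx
        fun ω => M.factual_eq_reduced (O := O) _ _
    · refine measurable_of_coin hcoin
        (g := fun p => M.reduced (Function.update (R p) A a) (fun s => ε s p.1) w) ?_ hfac hx
        fun ω => M.factual_eq_reduced (O := O) _ _
      refine M.measurable_reduced _ (fun p hp => ?_) hnoise'
      by_cases hpA : p = A
      · subst hpA
        simp only [Function.update_self]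
        exact measurable_const
      · simp only [Function.update_of_ne hpA]
        exact hcoord p hp
  have hCI : CondInd (μ.prod fairCoin) (insideAlg H τ ε v ⊔ coordAlg R S) (historyAlg M τ ε N v)
      (coordAlg R S) := by
    have h := condInd_of_sequential hRm (hnoise _) hout (indep_noise_coin hε hindep _)
      (ADMG.position τ) hτ.position_injective S (ADMG.position τ v) (fun w hw => ?_)
    · change CondInd _ (insideAlg H τ ε v ⊔ coordAlg R (S ∩ {u | ADMG.Precedes τ u v}))
        (historyAlg M τ ε N v)
        (coordAlg R (S ∩ {u | ADMG.Precedes τ u v})) at h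
      rwa [hSpre] at h
    · by_cases hwD : w ∈ D
      · refine .inl ⟨ADMG.mem_pillow_of_mem_prefixDistrict hwD ?_, ?_⟩
        · rintro rfl
          exact ADMG.not_precedes_self _ hw
        · exact hmeasD w hwD _ fun p hp => ⟨hτ.mem_pillow_of_dir hwD hp, hτ.precedes_of_dir hp⟩
      · exact .inr (hmeasR w hw hwD)
  rw [coordAlg_eq_comap S] at hCI
  have hX : Measurable fun p (u : S) => R p u := measurable_pi_lambda _ fun u => hRm u
  set K := condDistrib (fun p => R p v) (fun p (u : S) => R p u) (μ.prod fairCoin) with hK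
  have hmain : ∀ (C' : Set (Ω × Bool)) (b : Bool), MeasurableSet[historyAlg M τ ε N v] C' →
      ∀ {F : Set (𝒳 v)}, MeasurableSet F →
      μ ((fun ω => (ω, b)) ⁻¹' C' ∩ {ω | R (ω, b) v ∈ F}) =
        ∫⁻ ω in (fun ω => (ω, b)) ⁻¹' C', K (fun u => R (ω, b) u) F ∂μ := by
    intro C' b hC' F hF
    have hsnd : MeasurableSet[historyAlg M τ ε N v] (Prod.snd ⁻¹' {b} : Set (Ω × Bool)) :=
      (le_sup_right.trans le_sup_left : MeasurableSpace.comap Prod.snd _ ≤ historyAlg M τ ε N v) _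
        ⟨{b}, measurableSet_singleton b, rfl⟩
    have h1 := hCI.measure_inter_preimage hhist hX (hRm v)
      (by
        rw [← coordAlg_eq_comap (N := R) S]
        exact hmeasD v (ADMG.self_mem_prefixDistrict v) S fun p hp =>
          hτ.mem_pillow_of_dir (ADMG.self_mem_prefixDistrict v) hp)
      (hC'.inter hsnd) hF
    have h2 : C' ∩ Prod.snd ⁻¹' {b} = ((fun ω => (ω, b)) ⁻¹' C') ×ˢ {b} := by
      ext ⟨ω, b'⟩
      simp only [Set.mem_inter_iff, Set.mem_preimage, Set.mem_singleton_iff, Set.mem_prod]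
      constructor <;> (rintro ⟨h, rfl⟩; exact ⟨h, rfl⟩)
    have h3 : ((fun ω => (ω, b)) ⁻¹' C') ×ˢ {b} ∩ (fun p => R p v) ⁻¹' F
        = ((fun ω => (ω, b)) ⁻¹' C' ∩ {ω | R (ω, b) v ∈ F}) ×ˢ {b} := by
      ext ⟨ω, b'⟩
      simp only [Set.mem_inter_iff, Set.mem_preimage, Set.mem_singleton_iff, Set.mem_prod,
        Set.mem_ofPred_eq]
      constructor
      · rintro ⟨⟨h, rfl⟩, h'⟩; exact ⟨⟨h, h'⟩, rfl⟩
      · rintro ⟨⟨h, h'⟩, rfl⟩; exact ⟨⟨h, rfl⟩, h'⟩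
    rw [h2, h3, Measure.prod_prod, fairCoin_singleton, mul_comm,
      setLIntegral_prod_fairCoin (g := fun p => K (fun u => R p u) F)
        ((K.measurable_coe hF).comp hX)] at h1
    exact (ENNReal.mul_right_inj (by simp) (by simp)).1 h1
  -- in the factual world, the common version is `P(v ∣ mp(v))`
  have hfacm : Measurable fun ω (w : O) => M.factual (fun s => ε s ω) w :=
    measurable_pi_lambda _ fun w => measurable_factual hε w
  have hrestr : Measurable fun (o : ∀ w : O, 𝒳 w) (u : S) => o u :=
    measurable_pi_lambda _ fun u => measurable_pi_apply _
  have hKP : G.condLaw τ P v =ᵐ[P.map (fun o (u : S) => o u)] K := by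
    refine condDistrib_ae_eq_of_measure_eq_compProd _ (measurable_pi_apply v).aemeasurable ?_
    refine Measure.ext_prod fun {B F} hB hF => ?_
    have hpair : Measurable fun (o : ∀ w : O, 𝒳 w) => ((fun u : S => o u), o v) :=
      hrestr.prodMk (measurable_pi_apply v)
    rw [Measure.compProd_apply_prod hB hF, Measure.map_apply hpair (hB.prod hF),
      setLIntegral_map hB (K.measurable_coe hF) hrestr, hP,
      Measure.map_apply hfacm (hpair (hB.prod hF)),
      setLIntegral_map (f := fun o => K (fun u => o u) F) (hrestr hB)
        ((K.measurable_coe hF).comp hrestr) hfacm]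
    refine hmain ((fun p (u : S) => R p u) ⁻¹' B) false ?_ hF
    have h4 : MeasurableSet[coordAlg R S] ((fun p (u : S) => R p u) ⁻¹' B) := by
      rw [coordAlg_eq_comap S]
      exact ⟨B, hB, rfl⟩
    exact (le_trans (coordAlg_mono fun u hu => ADMG.precedes_of_mem_pillow hu) le_sup_right :
      coordAlg R S ≤ historyAlg M τ ε N v) _ h4
  have hNS : Measurable fun ω (u : S) => N ω u := measurable_pi_lambda _ fun u => hN u
  have hae := ae_of_ae_map hNS.aemeasurable (hac.ae_le hKP)
  refine (hmain C' true hC' hF).trans (lintegral_congr_ae ?_)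
  filter_upwards [hae] with ω hω
  exact congrArg (fun ν => ν F) hω.symm

end Transport

/-! ### Draws along the order, and events that they preserve -/

section KernelFacts

variable {α β : Type*} {mα : MeasurableSpace α} {mβ : MeasurableSpace β}

/-- A kernel that preserves an event almost surely commutes with the restriction to it. -/
theorem restrict_comp_of_ae (κ : Kernel α α) (ρ : Measure α) {S : Set α} (hS : MeasurableSet S)
    (h : ∀ o, ∀ᵐ q ∂(κ o), q ∈ S ↔ o ∈ S) : (κ ∘ₘ ρ).restrict S = κ ∘ₘ ρ.restrict S := by
  ext T hT
  rw [Measure.restrict_apply hT, Measure.bind_apply (hT.inter hS) κ.aemeasurable,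
    Measure.bind_apply hT κ.aemeasurable, ← lintegral_indicator hS]
  refine lintegral_congr fun o => ?_
  by_cases ho : o ∈ S
  · rw [Set.indicator_of_mem ho]
    refine measure_congr ?_
    filter_upwards [h o] with q hq
    exact propext ⟨fun h => h.1, fun h => ⟨h, hq.2 ho⟩⟩
  · rw [Set.indicator_of_notMem ho]
    refine measure_eq_zero_iff_ae_notMem.2 ?_
    filter_upwards [h o] with q hq hq'
    exact ho (hq.1 hq'.2)

/-- A Markov kernel that preserves the value of `f` almost surely does not change its law. -/
theorem map_comp_of_ae (κ : Kernel α α) [IsMarkovKernel κ] (ρ : Measure α) {f : α → β}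
    (hf : Measurable f) (h : ∀ o, ∀ᵐ q ∂(κ o), f q = f o) : (κ ∘ₘ ρ).map f = ρ.map f := by
  ext T hT
  rw [Measure.map_apply hf hT, Measure.map_apply hf hT,
    Measure.bind_apply (hf hT) κ.aemeasurable, ← lintegral_indicator_one (hf hT)]
  refine lintegral_congr fun o => ?_
  by_cases ho : o ∈ f ⁻¹' T
  · rw [Set.indicator_of_mem ho, Pi.one_apply, ← measure_univ (μ := κ o)]
    refine measure_congr ?_
    filter_upwards [h o] with q hq
    exact propext ⟨fun _ => trivial, fun _ => by
      change f q ∈ T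
      rw [hq]; exact ho⟩
  · rw [Set.indicator_of_notMem ho]
    refine measure_eq_zero_iff_ae_notMem.2 ?_
    filter_upwards [h o] with q hq hq'
    refine ho ?_
    change f o ∈ T
    rw [← hq]; exact hq'

end KernelFacts

namespace ADMG

section Draw

variable {W : Type*} {𝒳 : W → Type*} [∀ v, MeasurableSpace (𝒳 v)]
  [∀ v, StandardBorelSpace (𝒳 v)] [∀ v, Nonempty (𝒳 v)]
  (G : ADMG W) (τ : List W) (A : W) (P : Measure (∀ w, 𝒳 w)) [IsProbabilityMeasure P]

open Classical in
/-- The coordinates in the list `l` of `o`; the other coordinates are those of the point from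
which the identifying functional starts its draws. -/
noncomputable def mask (l : List W) (o : ∀ w, 𝒳 w) : ∀ w, 𝒳 w :=
  fun u => if u ∈ l then o u else Classical.arbitrary (∀ w, 𝒳 w) u

omit [∀ v, MeasurableSpace (𝒳 v)] [∀ v, StandardBorelSpace (𝒳 v)] in
theorem mask_of_mem {l : List W} {u : W} (hu : u ∈ l) (o : ∀ w, 𝒳 w) : mask l o u = o u :=
  if_pos hu

omit [∀ v, MeasurableSpace (𝒳 v)] [∀ v, StandardBorelSpace (𝒳 v)] in
theorem mask_of_notMem {l : List W} {u : W} (hu : u ∉ l) (o : ∀ w, 𝒳 w) :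
    mask l o u = Classical.arbitrary (∀ w, 𝒳 w) u :=
  if_neg hu

omit [∀ v, StandardBorelSpace (𝒳 v)] in
theorem measurable_mask_comp {Ω : Type*} {m : MeasurableSpace Ω} {l : List W}
    {X : Ω → ∀ w, 𝒳 w} (h : ∀ u ∈ l, Measurable fun ω => X ω u) :
    Measurable fun ω => mask l (X ω) := by
  refine measurable_pi_lambda _ fun u => ?_
  by_cases hu : u ∈ l
  · simp only [mask_of_mem hu]
    exact h u hu
  · simp only [mask_of_notMem hu]
    exact measurable_const

omit [∀ v, MeasurableSpace (𝒳 v)] [∀ v, StandardBorelSpace (𝒳 v)] in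
open Classical in
theorem mask_append_singleton (l : List W) (v : W) (o : ∀ w, 𝒳 w) :
    mask (l ++ [v]) o = Function.update (mask l o) v (o v) := by
  funext u
  by_cases hu : u = v
  · subst hu
    rw [Function.update_self, mask_of_mem (by simp)]
  · rw [Function.update_of_ne hu]
    simp [mask, hu]

omit [∀ v, MeasurableSpace (𝒳 v)] [∀ v, StandardBorelSpace (𝒳 v)] in
theorem pillowAt_mask {l : List W} {v : W} (hl : ∀ u ∈ G.pillow τ v, u ∈ l) (a : 𝒳 A)
    (o : ∀ w, 𝒳 w) : G.pillowAt τ A v a (mask l o) = G.pillowAt τ A v a o :=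
  G.pillowAt_congr τ a fun u hu _ => mask_of_mem (hl u hu) o

theorem product_append_singleton (c : W → 𝒳 A) (l : List W) (v : W) (o : ∀ w, 𝒳 w) :
    G.product τ A P c (l ++ [v]) o = G.draw τ A P v (c v) ∘ₘ G.product τ A P c l o := by
  rw [product_append, Kernel.comp_apply, product, product, Kernel.id_comp]

open Classical in
/-- Drawing the coordinate `v` extends the law of a random point `X` by a variable `x` whose
conditional distribution given `X` is the one that is drawn from. -/
theorem draw_comp_map {Ω : Type*} {mΩ : MeasurableSpace Ω} {ν : Measure Ω} [IsFiniteMeasure ν]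
    {X : Ω → ∀ w, 𝒳 w} (hX : Measurable X) {v : W} {x : Ω → 𝒳 v} (hx : Measurable x) (a : 𝒳 A)
    (h : ∀ B F, MeasurableSet B → MeasurableSet F → ν (X ⁻¹' B ∩ x ⁻¹' F)
      = ∫⁻ ω in X ⁻¹' B, G.condLaw τ P v (G.pillowAt τ A v a (X ω)) F ∂ν) :
    G.draw τ A P v a ∘ₘ ν.map X = ν.map fun ω => Function.update (X ω) v (x ω) := by
  have h1 : ν.map (fun ω => (X ω, x ω)) = ν.map X ⊗ₘ G.factor τ A P v a := by
    refine Measure.ext_prod fun {B F} hB hF => ?_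
    rw [Measure.compProd_apply_prod hB hF, Measure.map_apply (hX.prodMk hx) (hB.prod hF),
      setLIntegral_map hB (Kernel.measurable_coe _ hF) hX]
    exact h B F hB hF
  rw [draw, ← Measure.map_comp _ _ (measurable_updateAt v), ← Measure.compProd_eq_comp_prod, ← h1,
    Measure.map_map (measurable_updateAt v) (hX.prodMk hx)]
  rfl

theorem draw_ae_mem_iff {v : W} (hv : A ≠ v) (c a : 𝒳 A) (o : ∀ w, 𝒳 w) :
    ∀ᵐ q ∂(G.draw τ A P v c o), q ∈ {q : ∀ w, 𝒳 w | q A = a} ↔ o ∈ {q : ∀ w, 𝒳 w | q A = a} := by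
  filter_upwards [G.draw_ae τ A P v c o A hv] with q hq
  rw [hq]

theorem product_ae_mem_iff {l : List W} (hl : A ∉ l) (c : W → 𝒳 A) (a : 𝒳 A) (o : ∀ w, 𝒳 w) :
    ∀ᵐ q ∂(G.product τ A P c l o),
      q ∈ {q : ∀ w, 𝒳 w | q A = a} ↔ o ∈ {q : ∀ w, 𝒳 w | q A = a} := by
  filter_upwards [G.product_ae τ A P c l o A hl] with q hq
  rw [hq]

/-- The variables drawn after the treatment do not interfere with the event on which the
identifying measure is concentrated. -/
theorem branch_eq_comp {l s : List W} (hs : A ∉ s) (a₀ a : 𝒳 A) (hτ : l ++ s = τ) :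
    G.branch τ A P a₀ a = G.product τ A P (G.level τ A a₀ a) s ∘ₘ
      (G.product τ A P (G.level τ A a₀ a) l (Classical.arbitrary _)).restrict {o | o A = a} := by
  rw [← restrict_comp_of_ae _ _ (measurableSet_coord_eq A a)
    (G.product_ae_mem_iff τ A P hs (G.level τ A a₀ a) a), branch]
  congr 1
  rw [← Kernel.comp_apply, ← product_append, hτ]

theorem branch_map_pillowAt [Finite W] {l s : List W} {v : W} (hτ : G.IsTopologicalOrder τ)
    (hl : l ++ v :: s = τ) (hA : Precedes τ A v) (a₀ a b : 𝒳 A) :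
    (G.branch τ A P a₀ a).map (G.pillowAt τ A v b) =
      ((G.product τ A P (G.level τ A a₀ a) l (Classical.arbitrary _)).restrict
        {o | o A = a}).map (G.pillowAt τ A v b) := by
  have hnd : (l ++ v :: s).Nodup := hl ▸ hτ.1
  have hmem : ∀ u, Precedes τ u v → u ∉ v :: s := fun u hu => by
    rw [← hl, precedes_iff_mem_left hnd] at hu
    exact fun h => List.disjoint_of_nodup_append hnd hu h
  rw [G.branch_eq_comp τ A P (hmem A hA) a₀ a hl]
  refine map_comp_of_ae _ _ (G.measurable_pillowAt τ A v b) fun o => ?_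
  have h1 : ∀ᵐ q ∂(G.product τ A P (G.level τ A a₀ a) (v :: s) o),
      ∀ u : G.pillow τ v, q u = o u :=
    ae_all_iff.2 fun u => G.product_ae τ A P _ _ o u (hmem u (precedes_of_mem_pillow u.2))
  filter_upwards [h1] with q hq
  exact G.pillowAt_congr τ b fun u hu _ => hq ⟨u, hu⟩

end Draw

end ADMG

/-! ### The conditional distributions of the hybrid world -/

namespace ADMG

theorem mem_district_symm {W : Type*} {G : ADMG W} {u v : W} (h : u ∈ G.district v) :
    v ∈ G.district u := by
  have : Std.Symm G.bi := ⟨fun _ _ => G.bi_symm _ _⟩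
  exact Relation.ReflTransGen.stdSymm.symm _ _ h

end ADMG

section Hybrid

variable {V : Type*} [Finite V] {H : DAG V} {O : Set V}
  {𝒳 ℰ : V → Type*} [∀ v, MeasurableSpace (𝒳 v)] [∀ v, MeasurableSpace (ℰ v)]
  {M : SCM H 𝒳 ℰ} {Ω : Type*} [mΩ : MeasurableSpace Ω] {μ : Measure Ω}
  [IsProbabilityMeasure μ] {ε : ∀ v, Ω → ℰ v}

theorem measurable_potential (hε : ∀ v, Measurable (ε v)) (A : V) (a : 𝒳 A) (w : V) :
    Measurable fun ω => M.potential A a (fun s => ε s ω) w :=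
  (M.measurable_solve _ w).comp (measurable_pi_lambda _ hε)

theorem measurable_hybrid (hε : ∀ v, Measurable (ε v)) (A : O) (a : 𝒳 A) (w : O) :
    Measurable fun ω => M.hybrid A a (fun s => ε s ω) w := by
  by_cases hw : w = A
  · subst hw
    simp only [SCM.hybrid_treatment]
    exact measurable_factual hε _
  · simp only [fun ω => M.hybrid_of_ne a (fun s => ε s ω) hw]
    exact measurable_potential hε _ _ _

variable [∀ v : O, StandardBorelSpace (𝒳 v)] [∀ v : O, Nonempty (𝒳 v)]
  {P : Measure (∀ v : O, 𝒳 v)} [IsProbabilityMeasure P]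

/-- In the hybrid world, the conditional distribution of `v` given its past is the one from which
the identifying functional draws. If `v` is in the district of the treatment or does not follow
it, then no equation in the prefix district of `v` involves the treatment, so the hybrid world
itself is compared with the factual one; otherwise the variable responds to the treatment level
`a₀`, and the comparison is with the world of the potential outcomes, where the natural value of
the treatment is just a function of the past and of noises outside the district of `v`. -/
theorem measure_hybrid_inter_eq_setLIntegral
    (hε : ∀ v, Measurable (ε v)) (hindep : iIndepFun ε μ)
    (hP : P = μ.map (fun ω (v : O) => M.factual (fun w => ε w ω) v))
    {τ : List O} (hτ : (H.latentProjection O).IsTopologicalOrder τ) {A : O}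
    (hA : (H.latentProjection O).PrimalFixable A) (a₀ a : 𝒳 A) {l s : List O} {v : O}
    (hl : l ++ v :: s = τ) {B : Set (∀ w : O, 𝒳 w)} (hB : MeasurableSet B)
    (hBA : ADMG.Precedes τ A v → ∀ q ∈ B, q A = a)
    (hac : ADMG.Precedes τ A v →
      (μ.restrict ((fun ω => ADMG.mask l (M.hybrid A a₀ (fun s => ε s ω))) ⁻¹' B)).map
        (fun ω => (H.latentProjection O).pillowAt (𝒳 := fun v : O => 𝒳 v) τ A v
          ((H.latentProjection O).level (𝒳 := fun v : O => 𝒳 v) τ A a₀ a v)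
            (M.hybrid A a₀ (fun s => ε s ω))) ≪
        P.map (fun o (u : (H.latentProjection O).pillow τ v) => o u))
    {F : Set (𝒳 v)} (hF : MeasurableSet F) :
    μ ((fun ω => ADMG.mask l (M.hybrid A a₀ (fun s => ε s ω))) ⁻¹' B ∩
        {ω | M.hybrid A a₀ (fun s => ε s ω) v ∈ F}) =
      ∫⁻ ω in (fun ω => ADMG.mask l (M.hybrid A a₀ (fun s => ε s ω))) ⁻¹' B,
        (H.latentProjection O).condLaw τ P v
          ((H.latentProjection O).pillowAt (𝒳 := fun v : O => 𝒳 v) τ A v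
            ((H.latentProjection O).level (𝒳 := fun v : O => 𝒳 v) τ A a₀ a v)
            (ADMG.mask l (M.hybrid A a₀ (fun s => ε s ω)))) F ∂μ := by
  classical
  set G := H.latentProjection O with hG
  have hpre : ∀ u, ADMG.Precedes τ u v ↔ u ∈ l := fun u => by
    rw [← hl]
    exact ADMG.precedes_iff_mem_left (hl ▸ hτ.1) u
  have hpl : ∀ u ∈ G.pillow τ v, u ∈ l := fun u hu =>
    (hpre u).1 (ADMG.precedes_of_mem_pillow hu)
  simp only [fun o => G.pillowAt_mask (𝒳 := fun v : O => 𝒳 v) τ A hpl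
    (G.level (𝒳 := fun v : O => 𝒳 v) τ A a₀ a v) o]
  set C := (fun ω => ADMG.mask l (M.hybrid A a₀ (fun s => ε s ω))) ⁻¹' B with hC
  by_cases hcase : ADMG.Precedes τ A v ∧ v ∉ G.district A
  · obtain ⟨hAv, hvA⟩ := hcase
    have hlev : G.level (𝒳 := fun v : O => 𝒳 v) τ A a₀ a v = a₀ := if_neg fun h => hvA h.2
    rw [hlev] at hac ⊢
    have hvne : v ≠ A := by
      rintro rfl
      exact hvA .refl
    have hAD : A ∉ G.prefixDistrict τ v := fun h =>
      hvA (ADMG.mem_district_symm (ADMG.prefixDistrict_subset_district v h))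
    set N : Ω → ∀ w : O, 𝒳 w := fun ω w => M.potential A a₀ (fun s => ε s ω) w with hN
    have hNm : ∀ w, Measurable fun ω => N ω w := fun w => measurable_potential hε _ _ _
    -- the natural value of the treatment, reconstructed in either of the two worlds
    have hfac : ∀ ω, M.reduced (N ω) (fun s => ε s ω) A = M.factual (fun s => ε s ω) A := by
      intro ω
      have h := M.hybrid_eq_reduced hτ a₀ (fun s => ε s ω) A
      rw [M.update_hybrid, M.hybrid_treatment] at h
      exact h.symm
    have hpil : ∀ ω, G.pillowAt (𝒳 := fun v : O => 𝒳 v) τ A v a₀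
        (M.hybrid A a₀ (fun s => ε s ω)) = fun u : G.pillow τ v => N ω u := by
      intro ω
      funext ⟨u, hu⟩
      by_cases huA : u = A
      · subst huA
        rw [ADMG.pillowAt_treatment, hN]
        exact (M.potential_treatment _ _ _).symm
      · rw [ADMG.pillowAt_of_ne _ _ _ _ _ huA]
        exact M.hybrid_of_ne _ _ huA
    simp only [hpil] at hac ⊢
    set C' : Set (Ω × Bool) := (fun p => ADMG.mask l (Function.update (mixed M ε N p) A
      (M.reduced (mixed M ε N p) (fun s => ε s p.1) A))) ⁻¹' B with hC'
    have hCC : (fun ω => (ω, true)) ⁻¹' C' = C := by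
      ext ω
      change ADMG.mask l (Function.update (N ω) A (M.reduced (N ω) (fun s => ε s ω) A)) ∈ B ↔ _
      rw [hfac]
      rfl
    have hC'm : MeasurableSet[historyAlg M τ ε N v] C' := by
      refine ADMG.measurable_mask_comp (m := historyAlg M τ ε N v) (fun u hu => ?_) hB
      have hcoord : ∀ w, ADMG.Precedes τ w v →
          Measurable[historyAlg M τ ε N v] fun p => mixed M ε N p w := fun w hw =>
        (measurable_coordAlg (N := mixed M ε N) (T := {u | ADMG.Precedes τ u v}) hw).mono
          le_sup_right le_rfl
      by_cases huA : u = A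
      · subst huA
        simp only [Function.update_self]
        refine M.measurable_reduced _
          (fun p hp => hcoord p ((hτ.precedes_of_dir hp).trans hAv)) fun s hs => ?_
        exact (measurable_coordAlg (𝒳 := ℰ) (N := fun (p : Ω × Bool) s => ε s p.1)
          (noiseSet_subset_outside hAv hAD hs)).mono (le_sup_left.trans le_sup_left) le_rfl
      · simp only [Function.update_of_ne huA]
        exact hcoord u ((hpre u).2 hu)
    have hmain := measure_inter_eq_setLIntegral_condLaw hε hindep hP hτ v a₀ hNm
      (fun d hd ω => M.potential_eq_reduced A a₀ _ fun h => hAD (Subtype.ext h ▸ hd))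
      (fun w hw hwD => by
        by_cases hwA : w = A
        · subst hwA
          exact .inl ⟨a₀, fun ω => M.potential_treatment _ _ _⟩
        · refine .inr fun ω => ?_
          have h1 : Function.update (N ω) A a₀ = N ω := by
            rw [Function.update_eq_self_iff]
            exact (M.potential_treatment _ _ _).symm
          rw [h1]
          exact M.potential_eq_reduced A a₀ _ fun h => hwA (Subtype.ext h))
      hC'm (by rw [hCC]; exact hac hAv) hF
    rw [hCC] at hmain
    simp only [fun ω => M.hybrid_of_ne a₀ (fun s => ε s ω) hvne]
    exact hmain
  · set N : Ω → ∀ w : O, 𝒳 w := fun ω => M.hybrid A a₀ (fun s => ε s ω) with hN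
    have hNm : ∀ w, Measurable fun ω => N ω w := fun w => measurable_hybrid hε _ _ _
    have hCm : MeasurableSet C := ADMG.measurable_mask_comp (fun u _ => hNm u) hB
    -- no equation of the prefix district involves the treatment
    have hnodir : ∀ d ∈ G.prefixDistrict τ v, ¬ G.dir A d := by
      intro d hd hAd
      have hAv : ADMG.Precedes τ A v := by
        rcases ADMG.precedes_or_eq_of_mem_prefixDistrict hd with h | rfl
        exacts [(hτ.precedes_of_dir hAd).trans h, hτ.precedes_of_dir hAd]
      have hvA : v ∈ G.district A := by
        by_contra h
        exact hcase ⟨hAv, h⟩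
      have hmem : d ∈ G.children A ∩ G.district A :=
        ⟨hAd, Relation.ReflTransGen.trans hvA (ADMG.prefixDistrict_subset_district v hd)⟩
      rw [hA] at hmem
      exact hmem
    have hpil : ∀ ω ∈ C, G.pillowAt (𝒳 := fun v : O => 𝒳 v) τ A v
        (G.level (𝒳 := fun v : O => 𝒳 v) τ A a₀ a v) (N ω) = fun u : G.pillow τ v => N ω u := by
      intro ω hω
      funext ⟨u, hu⟩
      by_cases huA : u = A
      · subst huA
        have hAv : ADMG.Precedes τ u v := ADMG.precedes_of_mem_pillow hu
        have hvA : v ∈ G.district u := by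
          by_contra h
          exact hcase ⟨hAv, h⟩
        have hlev : G.level (𝒳 := fun v : O => 𝒳 v) τ u a₀ a v = a := if_pos ⟨.inr hAv, hvA⟩
        have hNA : ADMG.mask l (N ω) u = a := hBA hAv _ hω
        rw [ADMG.mask_of_mem ((hpre u).1 hAv)] at hNA
        rw [hlev, ADMG.pillowAt_treatment, hNA]
      · rw [ADMG.pillowAt_of_ne _ _ _ _ _ huA]
    set C' : Set (Ω × Bool) := (fun p => ADMG.mask l (mixed M ε N p)) ⁻¹' B with hC'
    have hCC : (fun ω => (ω, true)) ⁻¹' C' = C := rfl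
    have hC'm : MeasurableSet[historyAlg M τ ε N v] C' := by
      refine ADMG.measurable_mask_comp (m := historyAlg M τ ε N v) (fun u hu => ?_) hB
      exact (measurable_coordAlg (N := mixed M ε N) (T := {u | ADMG.Precedes τ u v})
        ((hpre u).2 hu)).mono le_sup_right le_rfl
    have hac' : (μ.restrict C).map (fun ω (u : G.pillow τ v) => N ω u) ≪
        P.map (fun o (u : G.pillow τ v) => o u) := by
      by_cases hAv : ADMG.Precedes τ A v
      · have h1 := hac hAv
        rwa [Measure.map_congr ((ae_restrict_mem hCm).mono hpil)] at h1
      · have h1 : (fun ω (u : G.pillow τ v) => N ω u)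
            = fun ω (u : G.pillow τ v) => M.factual (fun s => ε s ω) u := by
          funext ω u
          exact M.hybrid_eq_factual_of_not_precedes hτ a₀ _
            fun h => hAv (h.trans (ADMG.precedes_of_mem_pillow u.2))
        have hr : Measurable fun (o : ∀ w : O, 𝒳 w) (u : G.pillow τ v) => o u :=
          measurable_pi_lambda _ fun u => measurable_pi_apply _
        rw [h1, hP, Measure.map_map hr (measurable_pi_lambda _ fun w => measurable_factual hε w)]
        refine Measure.AbsolutelyContinuous.map Measure.absolutelyContinuous_restrict ?_
        exact hr.comp (measurable_pi_lambda _ fun w => measurable_factual hε w)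
    have hmain := measure_inter_eq_setLIntegral_condLaw hε hindep hP hτ v a₀ hNm
      (fun d hd ω => by
        refine (M.hybrid_eq_reduced hτ a₀ _ d).trans (M.reduced_congr _ _ fun p hp => ?_)
        have hpA : p ≠ A := by
          rintro rfl
          exact hnodir d hd hp
        rw [Function.update_of_ne hpA])
      (fun w hw hwD => .inr fun ω => M.hybrid_eq_reduced hτ a₀ _ w) hC'm hac' hF
    rw [hCC] at hmain
    refine hmain.trans (setLIntegral_congr_fun hCm fun ω hω => ?_)
    exact congrArg (fun x => G.condLaw τ P v x F) (hpil ω hω).symm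

end Hybrid

/-! ### The identifying measures are laws of the hybrid world -/

section Branch

variable {V : Type*} [Finite V] {H : DAG V} {O : Set V}
  {𝒳 ℰ : V → Type*} [∀ v, MeasurableSpace (𝒳 v)] [∀ v, MeasurableSpace (ℰ v)]
  {M : SCM H 𝒳 ℰ} {Ω : Type*} [mΩ : MeasurableSpace Ω] {μ : Measure Ω}
  [IsProbabilityMeasure μ] {ε : ∀ v, Ω → ℰ v}
  [∀ v : O, StandardBorelSpace (𝒳 v)] [∀ v : O, Nonempty (𝒳 v)]
  {P : Measure (∀ v : O, 𝒳 v)} [IsProbabilityMeasure P]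

omit [∀ v : O, StandardBorelSpace (𝒳 v)] in
theorem measurable_mask_hybrid (hε : ∀ v, Measurable (ε v)) (A : O) (a : 𝒳 A) (l : List O) :
    Measurable fun ω => ADMG.mask l (M.hybrid A a (fun s => ε s ω)) :=
  ADMG.measurable_mask_comp fun u _ => measurable_hybrid hε A a u

/-- Up to the treatment itself, the draws reproduce the law of the hybrid world, which is still the
factual one; no positivity is needed there. -/
theorem product_eq_map_hybrid (hε : ∀ v, Measurable (ε v)) (hindep : iIndepFun ε μ)
    (hP : P = μ.map (fun ω (v : O) => M.factual (fun w => ε w ω) v))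
    {τ : List O} (hτ : (H.latentProjection O).IsTopologicalOrder τ) {A : O}
    (hA : (H.latentProjection O).PrimalFixable A) (a₀ a : 𝒳 A) (l s : List O) (hl : l ++ s = τ)
    (hlA : ∀ u ∈ l, ¬ ADMG.Precedes τ A u) :
    (H.latentProjection O).product (𝒳 := fun v : O => 𝒳 v) τ A P
        ((H.latentProjection O).level (𝒳 := fun v : O => 𝒳 v) τ A a₀ a) l (Classical.arbitrary _)
      = μ.map fun ω => ADMG.mask l (M.hybrid A a₀ (fun s => ε s ω)) := by
  classical
  induction l using List.reverseRecOn generalizing s with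
  | nil =>
    have h : (fun ω => ADMG.mask ([] : List O) (M.hybrid A a₀ (fun s => ε s ω)))
        = fun _ => Classical.arbitrary (∀ v : O, 𝒳 v) := by
      funext ω u
      exact ADMG.mask_of_notMem (by simp) _
    rw [h, Measure.map_const, measure_univ, one_smul, ADMG.product, Kernel.id_apply]
  | append_singleton l v ih =>
    have hl' : l ++ v :: s = τ := by rw [← hl]; simp
    have hv := hlA v (by simp)
    rw [ADMG.product_append_singleton, ih (v :: s) hl' fun u hu => hlA u (by simp [hu]),
      ADMG.draw_comp_map _ _ _ _ (measurable_mask_hybrid hε A a₀ l)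
        (measurable_hybrid (M := M) hε A a₀ v)]
    · simp only [ADMG.mask_append_singleton]
    · intro B F hB hF
      exact measure_hybrid_inter_eq_setLIntegral hε hindep hP hτ hA a₀ a hl' hB
        (fun h => absurd h hv) (fun h => absurd h hv) hF

/-- Positivity for `v` in the hybrid world: on the event that the natural treatment is `a`, the
values at which the conditional distribution of `v` is evaluated avoid the null sets of the
factual law of the Markov pillow. -/
def HybridDominated (M : SCM H 𝒳 ℰ) (μ : Measure Ω) (ε : ∀ v, Ω → ℰ v) (P : Measure (∀ v : O, 𝒳 v))
    (τ : List O) (A : O) (a₀ a : 𝒳 A) (v : O) : Prop :=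
  (μ.restrict {ω | M.factual (fun s => ε s ω) A = a}).map
    (fun ω => (H.latentProjection O).pillowAt (𝒳 := fun v : O => 𝒳 v) τ A v
      ((H.latentProjection O).level (𝒳 := fun v : O => 𝒳 v) τ A a₀ a v)
        (M.hybrid A a₀ (fun s => ε s ω))) ≪
    P.map (fun o (u : (H.latentProjection O).pillow τ v) => o u)

/-- After the treatment, on the event that it is drawn as `a`, each further draw reproduces the law
of one more coordinate of the hybrid world. Positivity for `v` is only required once the coordinates
before `v` are known to have this law. -/
theorem product_restrict_eq_map_hybrid (hε : ∀ v, Measurable (ε v)) (hindep : iIndepFun ε μ)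
    (hP : P = μ.map (fun ω (v : O) => M.factual (fun w => ε w ω) v))
    {τ : List O} (hτ : (H.latentProjection O).IsTopologicalOrder τ) {A : O}
    (hA : (H.latentProjection O).PrimalFixable A) (a₀ a : 𝒳 A)
    (hpos : ∀ l s v, l ++ v :: s = τ → ADMG.Precedes τ A v →
      ((H.latentProjection O).product (𝒳 := fun v : O => 𝒳 v) τ A P
        ((H.latentProjection O).level (𝒳 := fun v : O => 𝒳 v) τ A a₀ a) l
          (Classical.arbitrary _)).restrict {o | o A = a}
        = (μ.restrict {ω | M.factual (fun s => ε s ω) A = a}).map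
          (fun ω => ADMG.mask l (M.hybrid A a₀ (fun s => ε s ω))) →
      HybridDominated M μ ε P τ A a₀ a v)
    (l₁ l₂ s : List O) (hl : l₁ ++ A :: (l₂ ++ s) = τ) :
    ((H.latentProjection O).product (𝒳 := fun v : O => 𝒳 v) τ A P
        ((H.latentProjection O).level (𝒳 := fun v : O => 𝒳 v) τ A a₀ a) (l₁ ++ A :: l₂)
          (Classical.arbitrary _)).restrict {o | o A = a}
      = (μ.restrict {ω | M.factual (fun s => ε s ω) A = a}).map
          fun ω => ADMG.mask (l₁ ++ A :: l₂) (M.hybrid A a₀ (fun s => ε s ω)) := by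
  classical
  have hnd : (l₁ ++ A :: (l₂ ++ s)).Nodup := hl ▸ hτ.1
  induction l₂ using List.reverseRecOn generalizing s with
  | nil =>
    rw [product_eq_map_hybrid hε hindep hP hτ hA a₀ a (l₁ ++ [A]) s (by rw [← hl]; simp),
      Measure.restrict_map (measurable_mask_hybrid hε A a₀ _) (ADMG.measurableSet_coord_eq A a)]
    · congr 2
      ext ω
      change ADMG.mask (l₁ ++ [A]) (M.hybrid A a₀ (fun s => ε s ω)) A = a ↔
        M.factual (fun s => ε s ω) A = a
      rw [ADMG.mask_of_mem (by simp), M.hybrid_treatment]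
    · intro u hu hAu
      rcases List.mem_append.1 hu with hu | hu
      · have h2 : ADMG.Precedes τ u A := by
          rw [← hl]
          exact (ADMG.precedes_iff_mem_left hnd u).2 hu
        exact ADMG.not_precedes_self _ (hAu.trans h2)
      · rw [List.mem_singleton.1 hu] at hAu
        exact ADMG.not_precedes_self _ hAu
  | append_singleton l₂ v ih =>
    have hl' : (l₁ ++ A :: l₂) ++ v :: s = τ := by rw [← hl]; simp
    have hl'' : l₁ ++ A :: (l₂ ++ v :: s) = τ := by rw [← hl]; simp
    have hAv : ADMG.Precedes τ A v := by
      rw [← hl', ADMG.precedes_iff_mem_left (hl' ▸ hτ.1)]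
      simp
    have hne : A ≠ v := by
      rintro rfl
      exact ADMG.not_precedes_self _ hAv
    have ih := ih (v :: s) hl'' (hl'' ▸ hτ.1)
    have hac := hpos _ _ _ hl' hAv ih
    rw [show l₁ ++ A :: (l₂ ++ [v]) = (l₁ ++ A :: l₂) ++ [v] by simp,
      ADMG.product_append_singleton, restrict_comp_of_ae _ _
        (ADMG.measurableSet_coord_eq (𝒳 := fun v : O => 𝒳 v) A a)
        (ADMG.draw_ae_mem_iff (𝒳 := fun v : O => 𝒳 v) _ τ A P hne _ a), ih,
      ADMG.draw_comp_map _ _ _ _ (measurable_mask_hybrid hε A a₀ _)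
        (measurable_hybrid (M := M) hε A a₀ v)]
    · simp only [ADMG.mask_append_singleton]
    · intro B F hB hF
      set X := fun ω => ADMG.mask (l₁ ++ A :: l₂) (M.hybrid A a₀ (fun s => ε s ω)) with hX
      have hXm : Measurable X := measurable_mask_hybrid hε A a₀ _
      have hXA : ∀ ω, X ω A = M.factual (fun s => ε s ω) A := fun ω => by
        rw [hX, ← M.hybrid_treatment A a₀]
        exact ADMG.mask_of_mem (by simp) _
      have hpre : X ⁻¹' B ∩ {ω | M.factual (fun s => ε s ω) A = a}
          = X ⁻¹' (B ∩ {o | o A = a}) := by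
        ext ω
        change _ ∧ _ = a ↔ _ ∧ X ω A = a
        rw [hXA]
        rfl
      rw [Measure.restrict_restrict (hXm hB), Measure.restrict_apply
        ((hXm hB).inter (measurable_hybrid hε A a₀ v hF)), Set.inter_right_comm, hpre]
      refine measure_hybrid_inter_eq_setLIntegral hε hindep hP hτ hA a₀ a hl'
        (B := B ∩ {o | o A = a})
        (hB.inter (ADMG.measurableSet_coord_eq (𝒳 := fun v : O => 𝒳 v) A a))
        (fun _ q hq => hq.2) (fun _ => ?_) hF
      refine (Measure.AbsolutelyContinuous.map (Measure.absolutelyContinuous_of_le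
        (Measure.restrict_mono_set μ ?_)) ?_).trans hac
      · rw [← hX, ← hpre]
        exact Set.inter_subset_right
      · exact (ADMG.measurable_pillowAt _ _ _ _ _).comp
          (measurable_pi_lambda _ fun w => measurable_hybrid hε A a₀ w)

theorem branch_eq_map_hybrid_of_dominated (hε : ∀ v, Measurable (ε v)) (hindep : iIndepFun ε μ)
    (hP : P = μ.map (fun ω (v : O) => M.factual (fun w => ε w ω) v))
    {τ : List O} (hτ : (H.latentProjection O).IsTopologicalOrder τ) {A : O}
    (hA : (H.latentProjection O).PrimalFixable A) (a₀ a : 𝒳 A)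
    (hpos : ∀ l s v, l ++ v :: s = τ → ADMG.Precedes τ A v →
      ((H.latentProjection O).product (𝒳 := fun v : O => 𝒳 v) τ A P
        ((H.latentProjection O).level (𝒳 := fun v : O => 𝒳 v) τ A a₀ a) l
          (Classical.arbitrary _)).restrict {o | o A = a}
        = (μ.restrict {ω | M.factual (fun s => ε s ω) A = a}).map
          (fun ω => ADMG.mask l (M.hybrid A a₀ (fun s => ε s ω))) →
      HybridDominated M μ ε P τ A a₀ a v) :
    (H.latentProjection O).branch (𝒳 := fun v : O => 𝒳 v) τ A P a₀ a
      = (μ.restrict {ω | M.factual (fun s => ε s ω) A = a}).map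
          fun ω => M.hybrid A a₀ (fun s => ε s ω) := by
  obtain ⟨l₁, l₂, hl⟩ := List.append_of_mem (hτ.2.1 A)
  have h := product_restrict_eq_map_hybrid hε hindep hP hτ hA a₀ a hpos l₁ l₂ []
    (by rw [hl, List.append_nil])
  rw [← hl] at h
  rw [ADMG.branch, h]
  congr 1
  funext ω u
  exact ADMG.mask_of_mem (hτ.2.1 u) _

/-- The identifying measure with the treatment level `a` in the district of the treatment is the
law of the hybrid world on the event that the natural treatment is `a`. -/
theorem branch_eq_map_hybrid (hε : ∀ v, Measurable (ε v)) (hindep : iIndepFun ε μ)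
    (hP : P = μ.map (fun ω (v : O) => M.factual (fun w => ε w ω) v))
    {τ : List O} (hτ : (H.latentProjection O).IsTopologicalOrder τ) {A : O}
    (hA : (H.latentProjection O).PrimalFixable A) (a₀ a : 𝒳 A)
    (hpos : (H.latentProjection O).Positivity (𝒳 := fun v : O => 𝒳 v) τ A P a₀ a) :
    (H.latentProjection O).branch (𝒳 := fun v : O => 𝒳 v) τ A P a₀ a
      = (μ.restrict {ω | M.factual (fun s => ε s ω) A = a}).map
          fun ω => M.hybrid A a₀ (fun s => ε s ω) := by
  refine branch_eq_map_hybrid_of_dominated hε hindep hP hτ hA a₀ a fun l s v hl hAv hlaw => ?_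
  have h := hpos v hAv
  rw [ADMG.branch_map_pillowAt _ _ _ _ hτ hl hAv, hlaw,
    Measure.map_map (ADMG.measurable_pillowAt _ _ _ _ _) (measurable_mask_hybrid hε A a₀ l)] at h
  have hpl : ∀ u ∈ (H.latentProjection O).pillow τ v, u ∈ l := fun u hu => by
    rw [← ADMG.precedes_iff_mem_left (hl ▸ hτ.1) u, hl]
    exact ADMG.precedes_of_mem_pillow hu
  have hcomp : (H.latentProjection O).pillowAt (𝒳 := fun v : O => 𝒳 v) τ A v
        ((H.latentProjection O).level (𝒳 := fun v : O => 𝒳 v) τ A a₀ a v) ∘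
          (fun ω => ADMG.mask l (M.hybrid A a₀ (fun s => ε s ω)))
      = fun ω => (H.latentProjection O).pillowAt (𝒳 := fun v : O => 𝒳 v) τ A v
        ((H.latentProjection O).level (𝒳 := fun v : O => 𝒳 v) τ A a₀ a v)
          (M.hybrid A a₀ (fun s => ε s ω)) :=
    funext fun ω => ADMG.pillowAt_mask (𝒳 := fun v : O => 𝒳 v) _ τ A hpl _ _
  rw [hcomp] at h
  exact h

/-- At the treatment level `a₀` the hybrid world is the factual one, and positivity is automatic. -/
theorem branch_self_eq_map_hybrid (hε : ∀ v, Measurable (ε v)) (hindep : iIndepFun ε μ)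
    (hP : P = μ.map (fun ω (v : O) => M.factual (fun w => ε w ω) v))
    {τ : List O} (hτ : (H.latentProjection O).IsTopologicalOrder τ) {A : O}
    (hA : (H.latentProjection O).PrimalFixable A) (a₀ : 𝒳 A) :
    (H.latentProjection O).branch (𝒳 := fun v : O => 𝒳 v) τ A P a₀ a₀
      = (μ.restrict {ω | M.factual (fun s => ε s ω) A = a₀}).map
          fun ω => M.hybrid A a₀ (fun s => ε s ω) := by
  refine branch_eq_map_hybrid_of_dominated hε hindep hP hτ hA a₀ a₀ fun l s v hl hAv _ => ?_
  have hE : MeasurableSet {ω | M.factual (fun s => ε s ω) A = a₀} :=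
    measurable_factual hε A (measurableSet_singleton a₀)
  have hr : Measurable fun (o : ∀ w : O, 𝒳 w) (u : (H.latentProjection O).pillow τ v) => o u :=
    measurable_pi_lambda _ fun u => measurable_pi_apply _
  have hfac : Measurable fun ω (w : O) => M.factual (fun s => ε s ω) w :=
    measurable_pi_lambda _ fun w => measurable_factual hε w
  have hlev : (H.latentProjection O).level (𝒳 := fun v : O => 𝒳 v) τ A a₀ a₀ v = a₀ := ite_self _
  have hae : (fun ω => (H.latentProjection O).pillowAt (𝒳 := fun v : O => 𝒳 v) τ A v a₀
      (M.hybrid A a₀ (fun s => ε s ω))) =ᵐ[μ.restrict {ω | M.factual (fun s => ε s ω) A = a₀}]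
      fun ω (u : (H.latentProjection O).pillow τ v) => M.factual (fun s => ε s ω) u := by
    filter_upwards [ae_restrict_mem hE] with ω hω
    funext ⟨u, hu⟩
    by_cases huA : u = A
    · subst huA
      rw [ADMG.pillowAt_treatment]
      exact hω.symm
    · rw [ADMG.pillowAt_of_ne _ _ _ _ _ huA]
      exact M.hybrid_eq_factual hω u
  rw [HybridDominated, hlev, Measure.map_congr hae, hP, Measure.map_map hr hfac]
  exact Measure.AbsolutelyContinuous.map Measure.absolutelyContinuous_restrict (hr.comp hfac)

end Branch

/-! ### The functional of the pre-treatment variables -/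

namespace ADMG

section Psi

variable {W : Type*} {𝒳 : W → Type*} [∀ v, MeasurableSpace (𝒳 v)]
  [∀ v, StandardBorelSpace (𝒳 v)] [∀ v, Nonempty (𝒳 v)]
  (G : ADMG W) (τ : List W) (A : W) (P : Measure (∀ w, 𝒳 w)) [IsProbabilityMeasure P]

/-- Let `P` give the variables that precede the treatment the law that the functional draws for
them. Then integrating out the treatment turns the identifying measure into the mixture of the laws
`postLaw`, weighted by the propensity, as far as coordinates other than the treatment are
concerned. -/
theorem lintegral_branch (hτ : G.IsTopologicalOrder τ) (a₀ a₁ : 𝒳 A) {l₁ l₂ : List W}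
    (hl : l₁ ++ A :: l₂ = τ)
    (hlaw : G.product τ A P (G.level τ A a₀ a₁) l₁ (Classical.arbitrary _) = P.map (mask l₁))
    {Y : W} (hY : Y ≠ A) {g : 𝒳 Y → ENNReal} (hg : Measurable g) :
    ∫⁻ o, g (o Y) ∂(G.branch τ A P a₀ a₁)
      = ∫⁻ o, G.condLaw τ P A (fun u => o u) {a₁} *
          ∫⁻ q, g (q Y) ∂(G.postLaw τ A P a₀ a₁ o) ∂P := by
  classical
  set c := G.level τ A a₀ a₁ with hc
  have hnd : (l₁ ++ A :: l₂).Nodup := hl ▸ hτ.1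
  have hpost : postTreatment τ A = l₂ := by rw [← hl]; exact postTreatment_append_cons hnd
  have hA₂ : A ∉ l₂ := (List.nodup_cons.1 (List.nodup_append.1 hnd).2.1).1
  have hgY : Measurable fun q : ∀ w, 𝒳 w => g (q Y) := hg.comp (measurable_pi_apply Y)
  have hmask : Measurable (mask (𝒳 := 𝒳) l₁) :=
    measurable_mask_comp (X := fun o => o) fun u _ => measurable_pi_apply u
  set Φ : (∀ w, 𝒳 w) → ENNReal := fun r => ∫⁻ q, g (q Y) ∂(G.product τ A P c l₂ r) with hΦ
  have hΦm : Measurable Φ := hgY.lintegral_kernel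
  have hS : MeasurableSet {o : ∀ w, 𝒳 w | o A = a₁} := measurableSet_coord_eq A a₁
  -- the draws after the treatment do not read the coordinates that are overwritten
  have hΦcongr : ∀ o o' : ∀ w, 𝒳 w, (∀ u, u ∉ l₂ → u ≠ A → o u = o' u) → Φ o = Φ o' := by
    intro o o' h
    have hpw : ∀ v ∈ l₂, v ∉ G.pillow τ v := fun v _ hv =>
      not_precedes_self _ (precedes_of_mem_pillow hv)
    have hpw2 : l₂.Pairwise fun u v => v ∉ G.pillow τ u := by
      have hsub : l₂.Sublist τ := hl ▸
        (List.sublist_cons_self _ _).trans (List.sublist_append_right _ _)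
      exact ((pairwise_precedes hτ.1).sublist hsub).imp fun huv hv =>
        Nat.lt_asymm huv (precedes_of_mem_pillow hv)
    have h1 := G.product_map_update_congr τ A P c a₁ l₂ hpw hpw2 o o' h hgY
    simpa only [Function.update_of_ne hY] using h1
  rw [G.branch_eq_comp τ A P (l := l₁ ++ [A]) hA₂ a₀ a₁ (by rw [← hl]; simp),
    product_append_singleton, hlaw,
    Measure.lintegral_bind (Kernel.aemeasurable _) hgY.aemeasurable]
  change ∫⁻ r in {o : ∀ w, 𝒳 w | o A = a₁}, Φ r ∂_ = _
  rw [← lintegral_indicator hS,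
    Measure.lintegral_bind (Kernel.aemeasurable _) (hΦm.indicator hS).aemeasurable,
    lintegral_map (Measurable.lintegral_kernel (hΦm.indicator hS)) hmask]
  refine lintegral_congr fun o => ?_
  have hpil : G.pillowAt τ A A (c A) (mask l₁ o) = fun u : G.pillow τ A => o u := by
    funext ⟨u, hu⟩
    have huA := precedes_of_mem_pillow hu
    have hne : u ≠ A := by
      rintro rfl
      exact not_precedes_self _ huA
    rw [pillowAt_of_ne _ _ _ _ _ hne, mask_of_mem]
    rwa [← hl, precedes_iff_mem_left hnd] at huA
  rw [lintegral_draw _ _ _ _ _ _ _ (hΦm.indicator hS), hpil]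
  have hval : Φ (Function.update (mask l₁ o) A a₁) = Φ o := by
    refine hΦcongr _ _ fun u hu huA => ?_
    rw [Function.update_of_ne huA, mask_of_mem]
    have h2 := hτ.2.1 u
    rw [← hl] at h2
    simpa [hu, huA] using h2
  have hind : (fun x => Set.indicator {o : ∀ w, 𝒳 w | o A = a₁} Φ
      (Function.update (mask l₁ o) A x)) = Set.indicator {a₁} fun _ => Φ o := by
    funext x
    by_cases hx : x = a₁
    · subst hx
      rw [Set.indicator_of_mem (by simp), Set.indicator_of_mem (by simp), hval]
    · rw [Set.indicator_of_notMem (by simpa using hx), Set.indicator_of_notMem (by simpa using hx)]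
  rw [hind, lintegral_indicator_const (measurableSet_singleton _), mul_comm, postLaw, hpost]

end Psi

end ADMG

/-! ### Identification -/

theorem integral_measure_comp {α β : Type*} {mα : MeasurableSpace α} {mβ : MeasurableSpace β}
    {κ : Kernel α β} [IsSFiniteKernel κ] {ν : Measure α} [SFinite ν] {f : β → ℝ}
    (hf : Integrable f (κ ∘ₘ ν)) : Integrable (fun x => ∫ z, f z ∂κ x) ν ∧
      ∫ z, f z ∂(κ ∘ₘ ν) = ∫ x, ∫ z, f z ∂κ x ∂ν := by
  have h : (κ ∘ₖ Kernel.const Unit ν) () = κ ∘ₘ ν := by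
    rw [Kernel.comp_apply, Kernel.const_apply]
  rw [← h] at hf ⊢
  exact ⟨hf.integral_comp, Kernel.integral_comp hf⟩

namespace ADMG

variable {W : Type*} {𝒳 : W → Type*} [∀ v, MeasurableSpace (𝒳 v)]
  [∀ v, StandardBorelSpace (𝒳 v)] [∀ v, Nonempty (𝒳 v)]
  (G : ADMG W) (τ : List W) (A : W) (P : Measure (∀ w, 𝒳 w)) [IsProbabilityMeasure P]

/-- The integral of a function of the outcome against the identifying measure, written as the
first term of the functional `psi`. -/
theorem integral_branch (hτ : G.IsTopologicalOrder τ) (a₀ a₁ : 𝒳 A) {l₁ l₂ : List W}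
    (hl : l₁ ++ A :: l₂ = τ)
    (hlaw : G.product τ A P (G.level τ A a₀ a₁) l₁ (Classical.arbitrary _) = P.map (mask l₁))
    {Y : W} (hY : Y ≠ A) {y : 𝒳 Y → ℝ} (hy : Measurable y)
    (hint : Integrable (fun o : ∀ v, 𝒳 v => y (o Y)) (G.branch τ A P a₀ a₁)) :
    (∀ᵐ o ∂P, G.propensity τ A P a₁ o ≠ 0 →
      Integrable (fun o' : ∀ v, 𝒳 v => y (o' Y)) (G.postLaw τ A P a₀ a₁ o)) ∧
    Integrable (fun o => G.propensity τ A P a₁ o *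
      (∫ o', y (o' Y) ∂(G.postLaw τ A P a₀ a₁ o))) P ∧
    ∫ o, y (o Y) ∂(G.branch τ A P a₀ a₁)
      = ∫ o, G.propensity τ A P a₁ o * (∫ o', y (o' Y) ∂(G.postLaw τ A P a₀ a₁ o)) ∂P := by
  have hκ : IsMarkovKernel (G.postLaw τ A P a₀ a₁) := by unfold postLaw; infer_instance
  have hYm : Measurable fun q : ∀ w, 𝒳 w => q Y := measurable_pi_apply Y
  set p : (∀ w, 𝒳 w) → ENNReal := fun o => G.condLaw τ P A (fun u => o u) {a₁} with hp
  have hpm : Measurable p := (Kernel.measurable_coe _ (measurableSet_singleton a₁)).comp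
    (measurable_pi_lambda _ fun u => measurable_pi_apply _)
  have hpt : ∀ o, p o < ⊤ := fun o => measure_lt_top _ _
  have hmap : (G.branch τ A P a₀ a₁).map (fun q => q Y)
      = (G.postLaw τ A P a₀ a₁ ∘ₘ P.withDensity p).map fun q => q Y := by
    ext B hB
    have h := G.lintegral_branch τ A P hτ a₀ a₁ hl hlaw hY
      (g := B.indicator 1) (measurable_one.indicator hB)
    have h1 : ∀ m : Measure (∀ w, 𝒳 w), ∫⁻ q, B.indicator 1 (q Y) ∂m = m.map (fun q => q Y) B := by
      intro m
      rw [← lintegral_map (f := B.indicator 1) (measurable_one.indicator hB) hYm,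
        lintegral_indicator_one hB]
    simp only [h1] at h
    rw [h, Measure.map_apply hYm hB, Measure.bind_apply (hYm hB) (Kernel.aemeasurable _),
      lintegral_withDensity_eq_lintegral_mul _ hpm (Kernel.measurable_coe _ (hYm hB))]
    refine lintegral_congr fun o => ?_
    rw [Measure.map_apply hYm hB]
    rfl
  have hint' : Integrable (fun o : ∀ v, 𝒳 v => y (o Y))
      (G.postLaw τ A P a₀ a₁ ∘ₘ P.withDensity p) := by
    have h2 := (integrable_map_measure hy.aestronglyMeasurable hYm.aemeasurable).2 hint
    rw [hmap] at h2
    exact (integrable_map_measure hy.aestronglyMeasurable hYm.aemeasurable).1 h2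
  have hcomp := integral_measure_comp hint'
  refine ⟨?_, ?_, ?_⟩
  · filter_upwards [(ae_withDensity_iff hpm).1
      (Measure.ae_integrable_of_integrable_comp hint')] with o ho hne
    refine ho fun h0 => hne ?_
    change (p o).toReal = 0
    rw [h0, ENNReal.toReal_zero]
  · exact (integrable_withDensity_iff_integrable_smul' hpm (ae_of_all _ hpt)).1 hcomp.1
  · rw [← integral_map (φ := fun q : ∀ w, 𝒳 w => q Y) hYm.aemeasurable hy.aestronglyMeasurable,
      hmap, integral_map hYm.aemeasurable hy.aestronglyMeasurable, hcomp.2,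
      integral_withDensity_eq_integral_toReal_smul hpm (ae_of_all _ hpt)]
    rfl

end ADMG

theorem mainTheorem5
    {V : Type*} [Finite V] (H : DAG V) (O : Set V)
    {𝒳 ℰ : V → Type*} [∀ v, MeasurableSpace (𝒳 v)] [∀ v, MeasurableSpace (ℰ v)]
    [∀ v : O, StandardBorelSpace (𝒳 v)] [∀ v : O, Nonempty (𝒳 v)]
    (M : SCM H 𝒳 ℰ)
    {Ω : Type*} [MeasurableSpace Ω] (μ : Measure Ω) [IsProbabilityMeasure μ]
    (ε : ∀ v, Ω → ℰ v) (hε : ∀ v, Measurable (ε v)) (hindep : iIndepFun ε μ)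
    (P : Measure (∀ v : O, 𝒳 v)) [IsProbabilityMeasure P]
    (hP : P = μ.map (fun ω (v : O) => M.factual (fun w => ε w ω) v))
    (G : ADMG O) (hG : G = H.latentProjection O)
    (A Y : O) (hAY : A ≠ Y)
    (τ : List O) (hτ : G.IsTopologicalOrder τ) (hY : τ.getLast? = some Y)
    (hA : G.PrimalFixable A)
    (a₀ a₁ : 𝒳 A) (ha : a₀ ≠ a₁) (hbinary : ∀ a : 𝒳 A, a = a₀ ∨ a = a₁)
    (y : 𝒳 Y → ℝ) (hy : Measurable y)
    (hpos : G.Positivity (𝒳 := fun v : O => 𝒳 v) τ A P a₀ a₁)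
    (hint : Integrable (fun ω => y (M.potential A a₀ (fun w => ε w ω) Y)) μ) :
    -- the functionals are well defined
    (Integrable (fun o : ∀ v : O, 𝒳 v => y (o Y)) (G.branch τ A P a₀ a₀) ∧
      Integrable (fun o : ∀ v : O, 𝒳 v => y (o Y)) (G.branch τ A P a₀ a₁) ∧
      Integrable (Set.indicator {o : ∀ v : O, 𝒳 v | o A = a₀} (fun o => y (o Y))) P ∧
      (∀ᵐ o ∂P, G.propensity τ A P a₁ o ≠ 0 →
        Integrable (fun o' : ∀ v : O, 𝒳 v => y (o' Y)) (G.postLaw τ A P a₀ a₁ o)) ∧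
      Integrable (fun o => G.propensity τ A P a₁ o *
        (∫ o', y (o' Y) ∂(G.postLaw τ A P a₀ a₁ o))) P) ∧
    -- and both of them identify the mean of the potential outcome
    ∫ ω, y (M.potential A a₀ (fun w => ε w ω) Y) ∂μ
      = G.tianFunctional (𝒳 := fun v : O => 𝒳 v) τ A Y P y a₀ a₁ ∧
    ∫ ω, y (M.potential A a₀ (fun w => ε w ω) Y) ∂μ
      = G.psi (𝒳 := fun v : O => 𝒳 v) τ A Y P y a₀ a₁ := by
  subst hG
  obtain ⟨l₁, l₂, hl⟩ := List.append_of_mem (hτ.2.1 A)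
  have hfac : Measurable fun ω (w : O) => M.factual (fun s => ε s ω) w :=
    measurable_pi_lambda _ fun w => measurable_factual hε w
  have hhyb : Measurable fun ω => M.hybrid A a₀ (fun s => ε s ω) :=
    measurable_pi_lambda _ fun w => measurable_hybrid hε A a₀ w
  have hyY : Measurable fun o : ∀ v : O, 𝒳 v => y (o Y) := hy.comp (measurable_pi_apply Y)
  have hE : ∀ a : 𝒳 A, MeasurableSet {ω | M.factual (fun s => ε s ω) A = a} := fun a =>
    measurable_factual hε A (measurableSet_singleton a)
  have hYhyb : ∀ ω, M.hybrid A a₀ (fun s => ε s ω) Y = M.potential A a₀ (fun s => ε s ω) Y :=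
    fun ω => M.hybrid_of_ne a₀ _ hAY.symm
  -- the two identifying measures are the laws of the hybrid world on `A = a₀` and on `A = a₁`
  have hb₀ := branch_self_eq_map_hybrid hε hindep hP hτ hA a₀
  have hb₁ := branch_eq_map_hybrid hε hindep hP hτ hA a₀ a₁ hpos
  have hi : ∀ {m : Measure (∀ v : O, 𝒳 v)} {a : 𝒳 A},
      m = (μ.restrict {ω | M.factual (fun s => ε s ω) A = a}).map
        (fun ω => M.hybrid A a₀ (fun s => ε s ω)) →
      Integrable (fun o : ∀ v : O, 𝒳 v => y (o Y)) m ∧ ∫ o, y (o Y) ∂m =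
        ∫ ω in {ω | M.factual (fun s => ε s ω) A = a},
          y (M.potential A a₀ (fun s => ε s ω) Y) ∂μ := by
    rintro m a rfl
    rw [integrable_map_measure hyY.aestronglyMeasurable hhyb.aemeasurable,
      integral_map hhyb.aemeasurable hyY.aestronglyMeasurable]
    simp only [Function.comp_def, hYhyb]
    exact ⟨hint.integrableOn, trivial⟩
  obtain ⟨hint₀, hval₀⟩ := hi hb₀
  obtain ⟨hint₁, hval₁⟩ := hi hb₁
  -- on `A = a₀` the hybrid world is the factual one
  have hS : MeasurableSet {o : ∀ v : O, 𝒳 v | o A = a₀} :=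
    ADMG.measurableSet_coord_eq (𝒳 := fun v : O => 𝒳 v) A a₀
  have hPb₀ : P.restrict {o | o A = a₀}
      = (H.latentProjection O).branch (𝒳 := fun v : O => 𝒳 v) τ A P a₀ a₀ := by
    rw [hb₀, hP, Measure.restrict_map hfac hS]
    refine Measure.map_congr ?_
    filter_upwards [ae_restrict_mem (hE a₀)] with ω hω
    funext w
    exact (M.hybrid_eq_factual hω w).symm
  have hlaw : (H.latentProjection O).product (𝒳 := fun v : O => 𝒳 v) τ A P
      ((H.latentProjection O).level (𝒳 := fun v : O => 𝒳 v) τ A a₀ a₁) l₁ (Classical.arbitrary _)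
      = P.map (ADMG.mask l₁) := by
    have hpre : ∀ u ∈ l₁, ¬ ADMG.Precedes τ A u := fun u hu hAu => by
      rw [hl] at hτ hAu
      exact Nat.lt_asymm hAu ((ADMG.precedes_iff_mem_left hτ.1 u).2 hu)
    rw [product_eq_map_hybrid hε hindep hP hτ hA a₀ a₁ l₁ (A :: l₂) hl.symm hpre, hP,
      Measure.map_map (ADMG.measurable_mask_comp (X := fun o : ∀ v : O, 𝒳 v => o)
        fun u _ => measurable_pi_apply u) hfac]
    congr 1
    funext ω u
    by_cases hu : u ∈ l₁
    · rw [Function.comp_apply, ADMG.mask_of_mem hu, ADMG.mask_of_mem hu]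
      exact M.hybrid_eq_factual_of_not_precedes hτ a₀ _ (hpre u hu)
    · rw [Function.comp_apply, ADMG.mask_of_notMem hu, ADMG.mask_of_notMem hu]
  obtain ⟨hpost, hprod, hval⟩ := (H.latentProjection O).integral_branch
    (𝒳 := fun v : O => 𝒳 v) τ A P hτ a₀ a₁ hl.symm hlaw hAY.symm hy hint₁
  have hsplit : ∫ ω, y (M.potential A a₀ (fun w => ε w ω) Y) ∂μ
      = ∫ o, y (o Y) ∂((H.latentProjection O).branch (𝒳 := fun v : O => 𝒳 v) τ A P a₀ a₀)
        + ∫ o, y (o Y) ∂((H.latentProjection O).branch (𝒳 := fun v : O => 𝒳 v) τ A P a₀ a₁) := by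
    have hcompl : {ω | M.factual (fun s => ε s ω) A = a₁}
        = {ω | M.factual (fun s => ε s ω) A = a₀}ᶜ := by
      ext ω
      change _ = a₁ ↔ ¬ _ = a₀
      exact ⟨fun h h' => ha (h'.symm.trans h), fun h => (hbinary _).resolve_left h⟩
    rw [hval₀, hval₁, hcompl, integral_add_compl (hE a₀) hint]
  refine ⟨⟨hint₀, hint₁, ?_, hpost, hprod⟩, hsplit, ?_⟩
  · rw [integrable_indicator_iff hS, IntegrableOn, hPb₀]
    exact hint₀
  · rw [hsplit, ADMG.psi, integral_indicator hS, hPb₀, hval, add_comm]
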